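/- **Setting.** Let $t_1<\dots<t_n$ be real numbers, and put $t_0=-\infty$, $t_{n+1}=+\infty$ (both stand for the vertex $\infty$). Let $a_1,\dots,a_n$ be integers. On the upper half plane let $f(z)=\prod_{k=1}^n (z-t_k)^{a_k/2}$ with principal powers; $F(z)=\int^z f(t)\,dt$ is the Schwarz–Christoffel map of the orthodisk with vertices $t_k$ and angles $(a_k+2)\pi/2$. A vertex is finite if $a_k>-2$. Its edges are the intervals $(t_k,t_{k+1})$, $0\le k\le n$. Two edges $(t_p,t_{p+1})$ and $(t_q,t_{q+1})$ with $p<q$ are parallel if $a_{p+1}+\dots+a_q$ is even. In that case, if $\gamma$ is an arc in the upper half plane joining the two edges and $\bar\gamma$ is the closed curve made of $\gamma$ and its mirror image in the real axis, oriented counterclockwise, the period of $\gamma$ is $F(\gamma)=\frac12\int_{\bar\gamma} f(t)\,dt$, where $f$ is continued analytically to the lower half plane across these edges. Two orthodisks with the same number $n$ of vertices and Schwarz–Christoffel maps $F_1,F_2$ are *conjugate* if there is a complex number $c\neq0$ such that $F_2(\gamma)=c\,\overline{F_1(\gamma)}$ for all arcs $\gamma$ joining two edges that are parallel in both orthodisks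 and have only finite vertices $t_{p+1},\dots,t_q$ (in both) between them, and such that the half-strips at the vertices of angle $0$ in both (those with $a_k=-2$) have the same width, that is, $|F_2(\gamma)|=|c|\,|F_1(\gamma)|$ for the arc $\gamma$ around such a vertex. Let $0\le i\le n$ and $1\le j\le n-1$ be such that the vertices $t_i,t_{i+1},t_j,t_{j+1}$ are distinct and $i-j$ is even. Let $\gamma$ be an arc joining the edges $(t_i,t_{i+1})$ and $(t_j,t_{j+1})$, and let $\beta$ be an arc joining the edges $(t_{j-1},t_j)$ and $(t_{j+1},t_{j+2})$. Consider a pair of conjugate orthodisks such that, in each of them, the exponents $a_k$ alternate between $-1$ and $+1$ along the vertices from $t_{i+1}$ to $t_{j+1}$ if $i<j$, and from $t_j$ to $t_i$ if $j<i$. In the $m$-th orthodisk ($m=1,2$) put $\delta_m=t_{j+1}-t_j$, keep all vertices except $t_{j+1}$ fixed, and regard $|F_m(\gamma)|$ and $|F_m(\beta)|$ as functions of small $\delta_m>0$. A function of $\delta>0$ is called real analytic at $\delta=0$ if for small $\delta>0$ it agrees with a function that is real analytic in a neighbourhood of $0$. **Lemma (Real Analyticity Alternative).** Exactly one of the two functions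 $$|F_1(\gamma)|-\frac{\log\delta_1}{\pi}|F_1(\beta)|,\qquad |F_1(\gamma)|+\frac{\log\delta_1}{\pi}|F_1(\beta)|$$ is real analytic at $\delta_1=0$. If it is the first one, then $|F_2(\gamma)|+\frac{\log\delta_2}{\pi}|F_2(\beta)|$ is real analytic at $\delta_2=0$; if it is the second one, then $|F_2(\gamma)|-\frac{\log\delta_2}{\pi}|F_2(\beta)|$ is real analytic at $\delta_2=0$. -/

import Mathlib

open Filter Topology

noncomputable section

/-- Schwarz–Christoffel data: `n` marked points `t 1, …, t n` on the real line (the point at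
infinity is the remaining vertex) and integers `a 1, …, a n`; the values of `t` and `a` outside
`1, …, n` play no role. -/
structure SCData (n : ℕ) where
  t : ℕ → ℝ
  a : ℕ → ℤ

/-- An orthodisk: the vertices are in increasing order on the real line. The vertex `t k` has the
interior angle `(a k + 2) π / 2`; it is a corner if `a k` is odd, and finite if `a k > -2`. -/
structure Orthodisk (n : ℕ) extends SCData n where
  strictMonoOn : StrictMonoOn t (Set.Icc 1 n)

namespace SCData

variable {n : ℕ}

/-- The integrand `(z - t₁)^(a₁/2) ⋯ (z - tₙ)^(aₙ/2)`, with principal powers. It is holomorphic on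
the open upper half plane and continuous up to the real line without the vertices. -/
def integrand (S : SCData n) (z : ℂ) : ℂ :=
  ∏ k ∈ Finset.Icc 1 n, (z - (S.t k : ℂ)) ^ ((S.a k : ℂ) / 2)

/-- The integrand on the upper half plane, continued analytically to the lower half plane across
the edge `(t q, t (q+1))`. There, the principal power of `z - t k` jumps by the factor `(-1)^(a k)`
for `k > q` and does not jump for `k ≤ q`. -/
def continued (S : SCData n) (q : ℕ) (z : ℂ) : ℂ :=
  if 0 ≤ z.im then S.integrand z
  else (-1 : ℂ) ^ (∑ k ∈ Finset.Ioc q n, S.a k) * S.integrand z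

/-- A point on edge number `k`, for `0 ≤ k ≤ n`: the edges are `(-∞, t 1)` for `k = 0`,
`(t n, ∞)` for `k = n`, and `(t k, t (k+1))` otherwise. -/
def edgePoint (S : SCData n) (k : ℕ) : ℝ :=
  if k = 0 then S.t 1 - 1
  else if k = n then S.t n + 1
  else (S.t k + S.t (k + 1)) / 2

/-- The period of the arc in the upper half plane that connects edge `p` with edge `q`, where
`p < q`: half the integral of the continued integrand over the closed curve made of the arc and its
mirror image in the real axis. The arc is represented by a half circle, so the closed curve is a
circle; it encloses `t (p+1), …, t q`. -/
def period (S : SCData n) (p q : ℕ) : ℂ :=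
  (1 / 2) * ∮ z in C(((S.edgePoint p + S.edgePoint q) / 2 : ℝ),
    (S.edgePoint q - S.edgePoint p) / 2), S.continued q z

/-- Edges `p < q` are parallel: an even number of corners lies between them. -/
def EdgesParallel (S : SCData n) (p q : ℕ) : Prop :=
  Even (∑ k ∈ Finset.Ioc p q, S.a k)

/-- All vertices between the edges `p < q` are finite. -/
def FiniteBetween (S : SCData n) (p q : ℕ) : Prop :=
  ∀ k ∈ Finset.Ioc p q, -2 < S.a k

/-- The exponents at the vertices `t p, …, t q` alternate between `-1` and `+1`. -/
def AlternatesOn (S : SCData n) (p q : ℕ) : Prop :=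
  (∀ k ∈ Finset.Icc p q, S.a k = 1 ∨ S.a k = -1) ∧
    ∀ k ∈ Finset.Ico p q, S.a (k + 1) = -S.a k

/-- Move `t (j+1)` to `t j + δ` and keep all the other vertices. -/
def moveVertex (S : SCData n) (j : ℕ) (δ : ℝ) : SCData n where
  t := Function.update S.t (j + 1) (S.t j + δ)
  a := S.a

/-- `|F(γ)|` as a function of `δ = t (j+1) - t j`, with `γ` connecting edge `i` with edge `j`. -/
def gammaLength (S : SCData n) (i j : ℕ) (δ : ℝ) : ℝ :=
  ‖(S.moveVertex j δ).period (min i j) (max i j)‖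

/-- `|F(β)|` as a function of `δ = t (j+1) - t j`, with `β` connecting edge `j-1` with edge
`j+1`. -/
def betaLength (S : SCData n) (j : ℕ) (δ : ℝ) : ℝ :=
  ‖(S.moveVertex j δ).period (j - 1) (j + 1)‖

end SCData

/-- Two consistently labelled orthodisks are conjugate if, up to normalization of the two maps by
a complex factor, corresponding periods between parallel edges are complex conjugate, and
corresponding half-strips (at the vertices of angle zero) have the same width. -/
def Orthodisk.IsConjugate {n : ℕ} (O₁ O₂ : Orthodisk n) : Prop :=
  ∃ c : ℂ, c ≠ 0 ∧
    (∀ p q : ℕ, p < q → q ≤ n →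
      O₁.EdgesParallel p q → O₂.EdgesParallel p q →
      O₁.FiniteBetween p q → O₂.FiniteBetween p q →
      O₂.period p q = c * (starRingEnd ℂ) (O₁.period p q)) ∧
    (∀ k ∈ Finset.Icc 1 n, O₁.a k = -2 → O₂.a k = -2 →
      ‖O₂.period (k - 1) k‖ = ‖c‖ * ‖O₁.period (k - 1) k‖)

/-- A function given for small `δ > 0` is real analytic at `δ = 0`: it agrees for small `δ > 0`
with a function that is real analytic in a full neighbourhood of `0`. -/
def ExtendsAnalyticallyToZero (f : ℝ → ℝ) : Prop :=
  ∃ g : ℝ → ℝ, AnalyticAt ℝ g 0 ∧ ∀ᶠ δ in 𝓝[>] (0 : ℝ), f δ = g δ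

/-- `|F(γ)| - (log δ / π) |F(β)|` is real analytic at `δ = 0`. -/
def SCData.MinusAnalytic {n : ℕ} (S : SCData n) (i j : ℕ) : Prop :=
  ExtendsAnalyticallyToZero fun δ =>
    S.gammaLength i j δ - Real.log δ / Real.pi * S.betaLength j δ

/-- `|F(γ)| + (log δ / π) |F(β)|` is real analytic at `δ = 0`. -/
def SCData.PlusAnalytic {n : ℕ} (S : SCData n) (i j : ℕ) : Prop :=
  ExtendsAnalyticallyToZero fun δ =>
    S.gammaLength i j δ + Real.log δ / Real.pi * S.betaLength j δ

end

namespace SCData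

variable {n : ℕ}

theorem norm_integrand (S : SCData n) (z : ℂ) :
    ‖S.integrand z‖ = ∏ k ∈ Finset.Icc 1 n, ‖z - (S.t k : ℂ)‖ ^ ((S.a k : ℝ) / 2) := by
  rw [integrand, norm_prod]
  refine Finset.prod_congr rfl fun k _ => ?_
  rw [← Complex.norm_cpow_real]
  push_cast
  rfl

theorem integrand_ne_zero (S : SCData n) {z : ℂ} (hz : ∀ k ∈ Finset.Icc 1 n, z ≠ S.t k) :
    S.integrand z ≠ 0 := by
  rw [integrand, Finset.prod_ne_zero_iff]
  intro k hk
  rw [Complex.cpow_ne_zero_iff]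
  exact Or.inl (sub_ne_zero.2 (hz k hk))

/-- A bound for the integrand at the points at height at most `1` above `z`. -/
noncomputable def majorant (S : SCData n) (z : ℂ) : ℝ :=
  ∏ k ∈ Finset.Icc 1 n, if S.a k < 0 then ‖z - (S.t k : ℂ)‖ ^ ((S.a k : ℝ) / 2)
    else (‖z - (S.t k : ℂ)‖ + 1) ^ ((S.a k : ℝ) / 2)

theorem norm_integrand_add_le_majorant (S : SCData n) {z : ℂ} {ε : ℝ} (hz : 0 ≤ z.im)
    (hε : 0 ≤ ε) (hε1 : ε ≤ 1) (hzt : ∀ k ∈ Finset.Icc 1 n, z ≠ S.t k) :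
    ‖S.integrand (z + ε * Complex.I)‖ ≤ S.majorant z := by
  rw [norm_integrand, majorant]
  refine Finset.prod_le_prod (fun k _ => by positivity) fun k hk => ?_
  have hpos : 0 < ‖z - (S.t k : ℂ)‖ := norm_pos_iff.2 (sub_ne_zero.2 (hzt k hk))
  split_ifs with h
  · refine Real.rpow_le_rpow_of_nonpos hpos ?_ ?_
    · rw [Complex.norm_def, Complex.norm_def]
      refine Real.sqrt_le_sqrt ?_
      simp only [Complex.normSq_apply, Complex.sub_re, Complex.sub_im, Complex.add_re,
        Complex.add_im, Complex.mul_re, Complex.mul_im, Complex.ofReal_re, Complex.ofReal_im,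
        Complex.I_re, Complex.I_im]
      nlinarith [mul_nonneg hz hε]
    · have : (S.a k : ℝ) < 0 := by exact_mod_cast h
      linarith
  · refine Real.rpow_le_rpow (norm_nonneg _) ?_ ?_
    · calc ‖z + ε * Complex.I - (S.t k : ℂ)‖ = ‖(z - (S.t k : ℂ)) + ε * Complex.I‖ := by ring_nf
        _ ≤ ‖z - (S.t k : ℂ)‖ + ‖(ε : ℂ) * Complex.I‖ := norm_add_le _ _
        _ ≤ _ := by
          gcongr
          simpa [abs_of_nonneg hε] using hε1
    · have : (0 : ℝ) ≤ (S.a k : ℝ) := by exact_mod_cast not_lt.1 h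
      linarith

theorem continuousWithinAt_cpow_upperHalfPlane {z : ℂ} (hz : z ≠ 0) (w : ℂ) :
    ContinuousWithinAt (fun x : ℂ => x ^ w) {x | 0 ≤ x.im} z := by
  by_cases hs : z ∈ Complex.slitPlane
  · exact (continuousAt_id.cpow continuousAt_const hs).continuousWithinAt
  · rw [Complex.mem_slitPlane_iff, not_or, not_lt, not_not] at hs
    have hre : z.re < 0 := lt_of_le_of_ne hs.1 fun h => hz (Complex.ext h hs.2)
    have hl := Complex.continuousWithinAt_log_of_re_neg_of_im_zero hre hs.2
    have h2 : ContinuousWithinAt (fun x : ℂ => Complex.exp (Complex.log x * w))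
        {x | 0 ≤ x.im} z :=
      Complex.continuous_exp.continuousAt.comp_continuousWithinAt (hl.mul continuousWithinAt_const)
    refine h2.congr_of_eventuallyEq ?_ (Complex.cpow_def_of_ne_zero hz w)
    filter_upwards [mem_nhdsWithin_of_mem_nhds (isOpen_ne.mem_nhds hz)] with x hx
    exact Complex.cpow_def_of_ne_zero hx w

theorem continuousWithinAt_integrand (S : SCData n) {z : ℂ}
    (hzt : ∀ k ∈ Finset.Icc 1 n, z ≠ S.t k) :
    ContinuousWithinAt S.integrand {x | 0 ≤ x.im} z := by
  refine ContinuousWithinAt.congr (f := fun x => ∏ k ∈ Finset.Icc 1 n,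
    (x - (S.t k : ℂ)) ^ ((S.a k : ℂ) / 2)) ?_ (fun _ _ => rfl) rfl
  refine tendsto_finsetProd _ fun k hk => ?_
  have h1 : ContinuousWithinAt (fun x : ℂ => x ^ ((S.a k : ℂ) / 2)) {x | 0 ≤ x.im}
      (z - (S.t k : ℂ)) :=
    continuousWithinAt_cpow_upperHalfPlane (sub_ne_zero.2 (hzt k hk)) _
  exact h1.comp (f := fun x : ℂ => x - (S.t k : ℂ))
    (continuousWithinAt_id.sub continuousWithinAt_const) fun x hx => by simpa using hx

theorem differentiableOn_integrand (S : SCData n) :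
    DifferentiableOn ℂ S.integrand {z | 0 < z.im} := by
  refine DifferentiableOn.congr (f := fun x => ∏ k ∈ Finset.Icc 1 n,
    (x - (S.t k : ℂ)) ^ ((S.a k : ℂ) / 2)) ?_ (fun _ _ => rfl)
  refine DifferentiableOn.fun_finsetProd fun k _ => ?_
  refine (differentiableOn_id.sub_const _).cpow_const fun z hz => ?_
  refine Complex.mem_slitPlane_iff.2 (Or.inr ?_)
  simpa using (ne_of_gt hz)

theorem tendsto_integral_integrand_add (S : SCData n) {γ γ' : ℝ → ℂ} (hγ : Continuous γ)
    (hγ' : Continuous γ') {a b : ℝ} (him : ∀ s ∈ Set.uIoc a b, 0 ≤ (γ s).im)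
    (hne : ∀ᵐ s, s ∈ Set.uIoc a b → ∀ k ∈ Finset.Icc 1 n, γ s ≠ S.t k)
    (hint : IntervalIntegrable (fun s => ‖γ' s‖ * S.majorant (γ s)) MeasureTheory.volume a b) :
    Tendsto (fun ε : ℝ => ∫ s in a..b, γ' s * S.integrand (γ s + ε * Complex.I)) (𝓝[>] 0)
      (𝓝 (∫ s in a..b, γ' s * S.integrand (γ s))) := by
  have hmem : Set.Ioc (0 : ℝ) 1 ∈ 𝓝[>] (0 : ℝ) := Ioc_mem_nhdsGT one_pos
  refine intervalIntegral.tendsto_integral_filter_of_dominated_convergence _ ?_ ?_ hint ?_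
  · filter_upwards [hmem] with ε hε
    refine ContinuousOn.aestronglyMeasurable ?_ measurableSet_uIoc
    refine hγ'.continuousOn.mul (S.differentiableOn_integrand.continuousOn.comp
      (by fun_prop) fun s hs => ?_)
    have := him s hs
    have := hε.1
    simp only [Set.mem_ofPred_eq, Complex.add_im, Complex.mul_im, Complex.ofReal_re,
        Complex.ofReal_im, Complex.I_re, Complex.I_im]
    linarith
  · filter_upwards [hmem] with ε hε
    filter_upwards [hne] with s hs hsI
    rw [norm_mul]
    gcongr
    exact S.norm_integrand_add_le_majorant (him s hsI) hε.1.le hε.2 (hs hsI)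
  · filter_upwards [hne] with s hs hsI
    refine tendsto_const_nhds.mul ?_
    have h := S.continuousWithinAt_integrand (hs hsI)
    refine h.tendsto.comp (tendsto_nhdsWithin_iff.2 ⟨?_, ?_⟩)
    · have : ContinuousAt (fun ε : ℝ => γ s + ε * Complex.I) 0 := by fun_prop
      have h2 := this.tendsto
      simp only [Complex.ofReal_zero, zero_mul, add_zero] at h2
      exact h2.mono_left nhdsWithin_le_nhds
    · filter_upwards [hmem] with ε hε
      have := him s hsI
      have := hε.1
      simp only [Complex.add_im, Complex.mul_im, Complex.ofReal_re,
        Complex.ofReal_im, Complex.I_re, Complex.I_im]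
      linarith

theorem _root_.circleMap_im (c R θ : ℝ) : (circleMap (c : ℂ) R θ).im = R * Real.sin θ := by
  simp [circleMap, Complex.exp_im, Complex.mul_im, Complex.mul_re, Complex.exp_re]

theorem integral_upper_arc_integrand_add (S : SCData n) (c R : ℝ) (hR : 0 < R) {ε : ℝ}
    (hε : 0 < ε) :
    ∫ θ in (0 : ℝ)..Real.pi, deriv (circleMap (c : ℂ) R) θ *
        S.integrand (circleMap (c : ℂ) R θ + ε * Complex.I) =
      -∫ x in (c - R)..(c + R), S.integrand (x + ε * Complex.I) := by
  set M : ℝ := R ^ 2 / (2 * ε) with hM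
  have hMpos : 0 < M := by positivity
  have hMε : 2 * M * ε = R ^ 2 := by rw [hM]; field_simp
  have hd : DifferentiableOn ℂ (fun z => S.integrand (z + ε * Complex.I))
      (Metric.ball ((c : ℂ) + M * Complex.I) (M + ε)) := by
    refine S.differentiableOn_integrand.comp (by fun_prop) fun z hz => ?_
    rw [Metric.mem_ball, dist_eq_norm] at hz
    have h1 := (abs_le.1 (Complex.abs_im_le_norm (z - (c + M * Complex.I)))).1
    simp only [Set.mem_ofPred_eq, Complex.add_im, Complex.mul_im, Complex.ofReal_re,
        Complex.ofReal_im, Complex.I_re, Complex.I_im, Complex.sub_im] at h1 ⊢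
    linarith
  obtain ⟨F, hF⟩ := hd.isExactOn_ball
  have hball : ∀ z : ℂ, 0 ≤ z.im → ‖z - c‖ ≤ R →
      z ∈ Metric.ball ((c : ℂ) + M * Complex.I) (M + ε) := by
    intro z hz hzc
    rw [Metric.mem_ball, dist_eq_norm]
    refine lt_of_pow_lt_pow_left₀ 2 (by positivity) ?_
    have h2 : ‖z - c‖ ^ 2 ≤ R ^ 2 := by gcongr
    rw [Complex.sq_norm, Complex.normSq_apply] at h2 ⊢
    simp only [Complex.add_im, Complex.mul_im, Complex.ofReal_re, Complex.add_re, Complex.mul_re,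
        Complex.ofReal_im, Complex.I_re, Complex.I_im, Complex.sub_im, Complex.sub_re] at h2 ⊢
    nlinarith [mul_nonneg hMpos.le hz]
  have harc : ∀ θ ∈ Set.uIcc (0 : ℝ) Real.pi,
      circleMap (c : ℂ) R θ ∈ Metric.ball ((c : ℂ) + M * Complex.I) (M + ε) := by
    intro θ hθ
    rw [Set.uIcc_of_le Real.pi_pos.le] at hθ
    refine hball _ ?_ ?_
    · rw [circleMap_im]
      exact mul_nonneg hR.le (Real.sin_nonneg_of_mem_Icc hθ)
    · rw [circleMap_sub_center, norm_circleMap_zero, abs_of_pos hR]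
  have hseg : ∀ x ∈ Set.uIcc (c - R) (c + R),
      (x : ℂ) ∈ Metric.ball ((c : ℂ) + M * Complex.I) (M + ε) := by
    intro x hx
    rw [Set.uIcc_of_le (by linarith)] at hx
    refine hball _ (by simp) ?_
    rw [← Complex.ofReal_sub, Complex.norm_real, Real.norm_eq_abs, abs_le]
    constructor <;> linarith [hx.1, hx.2]
  have e1 : ∫ θ in (0 : ℝ)..Real.pi, deriv (circleMap (c : ℂ) R) θ *
        S.integrand (circleMap (c : ℂ) R θ + ε * Complex.I) =
      F (circleMap (c : ℂ) R Real.pi) - F (circleMap (c : ℂ) R 0) := by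
    refine intervalIntegral.integral_eq_sub_of_hasDerivAt (f := fun θ => F (circleMap (c : ℂ) R θ))
      (fun θ hθ => ?_) ?_
    · rw [mul_comm]
      have h1 := hF _ (harc θ hθ)
      have h2 : HasDerivAt (circleMap (c : ℂ) R) (deriv (circleMap (c : ℂ) R) θ) θ :=
        (differentiable_circleMap _ _ _).hasDerivAt
      exact h1.comp_of_eq θ h2 rfl
    · refine ContinuousOn.intervalIntegrable (ContinuousOn.mul ?_ ?_)
      · rw [show deriv (circleMap (c : ℂ) R) = fun θ => circleMap 0 R θ * Complex.I from
          funext fun θ => deriv_circleMap _ _ θ]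
        fun_prop
      · exact hd.continuousOn.comp (by fun_prop) harc
  have e2 : ∫ x in (c - R)..(c + R), S.integrand (x + ε * Complex.I) =
      F ((c + R : ℝ) : ℂ) - F ((c - R : ℝ) : ℂ) := by
    refine intervalIntegral.integral_eq_sub_of_hasDerivAt (f := fun x : ℝ => F (x : ℂ))
      (fun x hx => ?_) ?_
    · have h1 := hF _ (hseg x hx)
      exact h1.comp_ofReal
    · exact (hd.continuousOn.comp (by fun_prop) hseg).intervalIntegrable
  rw [e1, e2]
  have h3 : circleMap (c : ℂ) R Real.pi = ((c - R : ℝ) : ℂ) := by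
    simp [circleMap, sub_eq_add_neg]
  have h4 : circleMap (c : ℂ) R 0 = ((c + R : ℝ) : ℂ) := by
    simp [circleMap]
  rw [h3, h4]
  ring

end SCData

open MeasureTheory in
theorem integrableAtFilter_abs_sub_rpow (t : ℝ) {r : ℝ} (hr : -1 < r) :
    IntegrableAtFilter (fun x : ℝ => |x - t| ^ r) (𝓝 t) := by
  have h : LocallyIntegrable (fun x : ℝ => |x| ^ r) := by
    refine locallyIntegrable_of_norm_le_rpow (C := 1) (α := -r) (by simp)
      (by simpa using (by linarith : -r < 1)) (Eventually.of_forall fun x => ?_) ?_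
    · rw [neg_neg, one_mul, Real.norm_of_nonneg (by positivity), Real.norm_eq_abs]
    · exact (by fun_prop : Measurable fun x : ℝ => |x| ^ r).aestronglyMeasurable
  have h1 : IntegrableOn (fun x : ℝ => |x| ^ r) (Metric.closedBall 0 1) :=
    h.integrableOn_isCompact (isCompact_closedBall _ _)
  have h2 := ((measurePreserving_sub_right volume t).integrableOn_comp_preimage
    (MeasurableEquiv.subRight t).measurableEmbedding).2 h1
  refine ⟨_, ?_, h2⟩
  have hc : ContinuousAt (fun x : ℝ => x - t) t := by fun_prop
  refine hc.preimage_mem_nhds ?_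
  rw [sub_self]
  exact Metric.closedBall_mem_nhds _ one_pos

open MeasureTheory in
theorem integrableOn_prod_of_singleton_singularities {ι : Type*} (s : Finset ι) (t : ι → ℝ)
    (b : ι → ℝ → ℝ) (hb : ∀ k ∈ s, ∀ x, x ≠ t k → ContinuousAt (b k) x) {K : Set ℝ}
    (hK : IsCompact K)
    (h : ∀ k ∈ s, t k ∈ K →
      IntegrableAtFilter (b k) (𝓝 (t k)) ∧ ∀ l ∈ s, t l = t k → l = k) :
    IntegrableOn (fun x => ∏ k ∈ s, b k x) K := by
  classical
  refine LocallyIntegrableOn.integrableOn_isCompact (fun x hx => ?_) hK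
  suffices H : IntegrableAtFilter (fun x => ∏ k ∈ s, b k x) (𝓝 x) from
    H.filter_mono nhdsWithin_le_nhds
  have key : ∀ u : Finset ι, u ⊆ s → (∀ k ∈ u, t k ≠ x) → ∀ f : ℝ → ℝ,
      IntegrableAtFilter f (𝓝 x) → IntegrableAtFilter (fun y => f y * ∏ k ∈ u, b k y) (𝓝 x) := by
    intro u hu hux f hf
    obtain ⟨V, hV, hfV⟩ := hf
    have hW : V ∩ {y | ∀ k ∈ u, t k ≠ y} ∈ 𝓝 x := by
      refine inter_mem hV ?_
      have : ∀ᶠ y in 𝓝 x, ∀ k ∈ u, t k ≠ y := by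
        rw [Filter.eventually_all_finset]
        intro k hk
        filter_upwards [isOpen_ne.mem_nhds (hux k hk).symm] with y hy using Ne.symm hy
      exact this
    obtain ⟨r, hr, hrW⟩ := Metric.nhds_basis_closedBall.mem_iff.1 hW
    refine ⟨_, Metric.closedBall_mem_nhds x hr, ?_⟩
    refine (hfV.mono_set fun y hy => (hrW hy).1).mul_continuousOn ?_ (isCompact_closedBall _ _)
    intro y hy
    refine ContinuousAt.continuousWithinAt ?_
    refine tendsto_finsetProd _ fun k hk => ?_
    exact hb k (hu hk) y ((hrW hy).2 k hk).symm
  by_cases hex : ∃ k ∈ s, t k = x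
  · obtain ⟨k, hk, rfl⟩ := hex
    obtain ⟨h1, h2⟩ := h k hk hx
    have h3 := key (s.erase k) (Finset.erase_subset _ _) (fun l hl hlk =>
      (Finset.mem_erase.1 hl).1 (h2 l (Finset.mem_erase.1 hl).2 hlk)) _ h1
    refine h3.congr (Eventually.of_forall fun y => ?_)
    exact Finset.mul_prod_erase s (fun l => b l y) hk
  · push Not at hex
    have h3 := key s subset_rfl hex (fun _ => 1) ⟨Metric.closedBall x 1,
      Metric.closedBall_mem_nhds x one_pos, by simp⟩
    simpa using h3

namespace SCData

variable {n : ℕ}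

open MeasureTheory in
theorem integrableOn_majorant (S : SCData n) {K : Set ℝ} (hK : IsCompact K)
    (h : ∀ k ∈ Finset.Icc 1 n, S.t k ∈ K →
      -2 < S.a k ∧ ∀ l ∈ Finset.Icc 1 n, S.t l = S.t k → l = k) :
    IntegrableOn (fun x : ℝ => S.majorant x) K := by
  refine integrableOn_prod_of_singleton_singularities (Finset.Icc 1 n) S.t
    (fun k x => if S.a k < 0 then ‖(x : ℂ) - (S.t k : ℂ)‖ ^ ((S.a k : ℝ) / 2)
    else (‖(x : ℂ) - (S.t k : ℂ)‖ + 1) ^ ((S.a k : ℝ) / 2)) ?_ hK ?_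
  · intro k _ x hx
    have h0 : ‖(x : ℂ) - (S.t k : ℂ)‖ ≠ 0 := by
      rw [← Complex.ofReal_sub, Complex.norm_real]
      exact norm_ne_zero_iff.2 (sub_ne_zero.2 hx)
    split_ifs
    · exact ContinuousAt.rpow_const (by fun_prop) (Or.inl h0)
    · exact ContinuousAt.rpow_const (by fun_prop) (Or.inl (by positivity))
  · intro k hk hkK
    obtain ⟨h1, h2⟩ := h k hk hkK
    refine ⟨?_, h2⟩
    split_ifs with ha
    · have h3 := integrableAtFilter_abs_sub_rpow (S.t k) (r := (S.a k : ℝ) / 2)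
        (by have : (-2 : ℝ) < S.a k := by exact_mod_cast h1
            linarith)
      refine h3.congr (Eventually.of_forall fun x => ?_)
      simp only
      rw [← Complex.ofReal_sub, Complex.norm_real, Real.norm_eq_abs]
    · refine ⟨_, Metric.closedBall_mem_nhds _ one_pos,
        ContinuousOn.integrableOn_compact (isCompact_closedBall _ _) ?_⟩
      exact (Continuous.rpow_const (by fun_prop) fun x => Or.inl (by positivity)).continuousOn

theorem norm_integrand_ofReal (S : SCData n) (x : ℝ) :
    ‖S.integrand x‖ = ∏ k ∈ Finset.Icc 1 n, |x - S.t k| ^ ((S.a k : ℝ) / 2) := by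
  rw [norm_integrand]
  refine Finset.prod_congr rfl fun k _ => ?_
  rw [← Complex.ofReal_sub, Complex.norm_real, Real.norm_eq_abs]

open MeasureTheory in
theorem integrableOn_norm_integrand (S : SCData n) {K : Set ℝ} (hK : IsCompact K)
    (h : ∀ k ∈ Finset.Icc 1 n, S.t k ∈ K →
      -2 < S.a k ∧ ∀ l ∈ Finset.Icc 1 n, S.t l = S.t k → l = k) :
    IntegrableOn (fun x : ℝ => ‖S.integrand x‖) K := by
  simp only [norm_integrand_ofReal]
  refine integrableOn_prod_of_singleton_singularities (Finset.Icc 1 n) S.t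
    (fun k x => |x - S.t k| ^ ((S.a k : ℝ) / 2)) ?_ hK ?_
  · intro k _ x hx
    exact ContinuousAt.rpow_const (by fun_prop) (Or.inl (by simpa [sub_eq_zero] using hx))
  · intro k hk hkK
    obtain ⟨h1, h2⟩ := h k hk hkK
    exact ⟨integrableAtFilter_abs_sub_rpow (S.t k) (by
      have : (-2 : ℝ) < S.a k := by exact_mod_cast h1
      linarith), h2⟩

theorem majorant_continuousAt (S : SCData n) {z : ℂ} (hz : ∀ k ∈ Finset.Icc 1 n, z ≠ S.t k) :
    ContinuousAt S.majorant z := by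
  unfold majorant
  refine tendsto_finsetProd _ fun k hk => ?_
  have h0 : ‖z - (S.t k : ℂ)‖ ≠ 0 := norm_ne_zero_iff.2 (sub_ne_zero.2 (hz k hk))
  split_ifs
  · exact ContinuousAt.rpow_const (by fun_prop) (Or.inl h0)
  · exact ContinuousAt.rpow_const (by fun_prop) (Or.inl (by positivity))

theorem ae_ne_vertex (S : SCData n) : ∀ᵐ x : ℝ, ∀ k ∈ Finset.Icc 1 n, x ≠ S.t k := by
  rw [Filter.eventually_all_finset]
  intro k _
  exact MeasureTheory.Measure.ae_ne _ _

theorem circleMap_ne_ofReal {c R θ t : ℝ} (hR : 0 < R) (h1 : t ≠ c - R) (h2 : t ≠ c + R) :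
    circleMap (c : ℂ) R θ ≠ t := by
  intro h
  have h3 : ‖circleMap (c : ℂ) R θ - c‖ = R := by
    rw [circleMap_sub_center, norm_circleMap_zero, abs_of_pos hR]
  rw [h, ← Complex.ofReal_sub, Complex.norm_real, Real.norm_eq_abs] at h3
  rcases abs_eq hR.le |>.1 h3 with h4 | h4
  · exact h2 (by linarith)
  · exact h1 (by linarith)

/-- The Cauchy theorem for the upper half disc. -/
theorem integral_upper_arc_integrand (S : SCData n) (c R : ℝ) (hR : 0 < R)
    (hne : ∀ k ∈ Finset.Icc 1 n, S.t k ≠ c - R ∧ S.t k ≠ c + R)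
    (h : ∀ k ∈ Finset.Icc 1 n, S.t k ∈ Set.Icc (c - R) (c + R) →
      -2 < S.a k ∧ ∀ l ∈ Finset.Icc 1 n, S.t l = S.t k → l = k) :
    ∫ θ in (0 : ℝ)..Real.pi, deriv (circleMap (c : ℂ) R) θ * S.integrand (circleMap (c : ℂ) R θ) =
      -∫ x in (c - R)..(c + R), S.integrand x := by
  have hder : deriv (circleMap (c : ℂ) R) = fun θ => circleMap 0 R θ * Complex.I :=
    funext fun θ => deriv_circleMap _ _ θ
  have hcirc : ∀ θ, ∀ k ∈ Finset.Icc 1 n, circleMap (c : ℂ) R θ ≠ S.t k := fun θ k hk =>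
    circleMap_ne_ofReal hR (hne k hk).1 (hne k hk).2
  have t1 := S.tendsto_integral_integrand_add (γ := circleMap (c : ℂ) R)
    (γ' := deriv (circleMap (c : ℂ) R)) (a := 0) (b := Real.pi) (by fun_prop)
    (by rw [hder]; fun_prop)
    (fun θ hθ => by
      rw [circleMap_im]
      rw [Set.uIoc_of_le Real.pi_pos.le] at hθ
      exact mul_nonneg hR.le (Real.sin_nonneg_of_mem_Icc ⟨hθ.1.le, hθ.2⟩))
    (Eventually.of_forall fun θ _ => hcirc θ)
    (by
      refine Continuous.intervalIntegrable (Continuous.mul ?_ ?_) _ _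
      · rw [hder]; fun_prop
      · refine continuous_iff_continuousAt.2 fun θ => ?_
        exact (S.majorant_continuousAt (hcirc θ)).comp
          (f := circleMap (c : ℂ) R) (continuous_circleMap _ _).continuousAt)
  have t2 := S.tendsto_integral_integrand_add (γ := fun x : ℝ => (x : ℂ))
    (γ' := fun _ => 1) (a := c - R) (b := c + R) (by fun_prop) (by fun_prop)
    (fun x _ => by simp)
    (by
      filter_upwards [S.ae_ne_vertex] with x hx _ k hk
      exact_mod_cast hx k hk)
    (by
      simp only [norm_one, one_mul]
      rw [intervalIntegrable_iff_integrableOn_Icc_of_le (by linarith)]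
      exact S.integrableOn_majorant isCompact_Icc h)
  simp only [one_mul] at t2
  refine tendsto_nhds_unique t1 (t2.neg.congr' ?_)
  filter_upwards [self_mem_nhdsWithin] with ε hε
  exact (S.integral_upper_arc_integrand_add c R hR hε).symm

theorem integrand_conj (S : SCData n) {z : ℂ} (hz : z.im ≠ 0) :
    S.integrand ((starRingEnd ℂ) z) = (starRingEnd ℂ) (S.integrand z) := by
  rw [integrand, integrand, map_prod]
  refine Finset.prod_congr rfl fun k _ => ?_
  have harg : (z - (S.t k : ℂ)).arg ≠ Real.pi := by
    intro h
    rw [Complex.arg_eq_pi_iff] at h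
    exact hz (by simpa using h.2)
  have h := Complex.cpow_conj (z - (S.t k : ℂ)) ((S.a k : ℂ) / 2) harg
  have h2 : (starRingEnd ℂ) ((S.a k : ℂ) / 2) = (S.a k : ℂ) / 2 := by
    rw [map_div₀, map_intCast, map_ofNat]
  rw [h2] at h
  rw [h, Complex.conj_conj, map_sub, Complex.conj_ofReal]

theorem circleMap_two_pi_sub (c R θ : ℝ) :
    circleMap (c : ℂ) R (2 * Real.pi - θ) = (starRingEnd ℂ) (circleMap (c : ℂ) R θ) := by
  apply Complex.ext <;>
  simp [circleMap, Complex.exp_re, Complex.exp_im, Complex.mul_re, Complex.mul_im,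
    Real.cos_two_pi_sub, Real.sin_two_pi_sub]

theorem circleIntegral_continued (S : SCData n) (q : ℕ) (c R : ℝ) (hR : 0 < R)
    (hne : ∀ k ∈ Finset.Icc 1 n, S.t k ≠ c - R ∧ S.t k ≠ c + R) :
    (∮ z in C(c, R), S.continued q z) =
      (∫ θ in (0 : ℝ)..Real.pi, deriv (circleMap (c : ℂ) R) θ *
        S.integrand (circleMap (c : ℂ) R θ)) -
      (-1 : ℂ) ^ (∑ k ∈ Finset.Ioc q n, S.a k) *
        (starRingEnd ℂ) (∫ θ in (0 : ℝ)..Real.pi, deriv (circleMap (c : ℂ) R) θ *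
          S.integrand (circleMap (c : ℂ) R θ)) := by
  set N := ∑ k ∈ Finset.Ioc q n, S.a k
  set u : ℝ → ℂ := fun θ => deriv (circleMap (c : ℂ) R) θ * S.integrand (circleMap (c : ℂ) R θ)
    with hu
  set w : ℝ → ℂ := fun θ => deriv (circleMap (c : ℂ) R) θ * S.continued q (circleMap (c : ℂ) R θ)
    with hw
  have hder : deriv (circleMap (c : ℂ) R) = fun θ => circleMap 0 R θ * Complex.I :=
    funext fun θ => deriv_circleMap _ _ θ
  have hui : IntervalIntegrable u MeasureTheory.volume 0 Real.pi := by
    refine ContinuousOn.intervalIntegrable (ContinuousOn.mul ?_ ?_)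
    · rw [hder]; fun_prop
    · intro θ hθ
      rw [Set.uIcc_of_le Real.pi_pos.le] at hθ
      refine (S.continuousWithinAt_integrand fun k hk =>
        circleMap_ne_ofReal hR (hne k hk).1 (hne k hk).2).comp (f := circleMap (c : ℂ) R)
        (continuous_circleMap _ _).continuousWithinAt fun φ hφ => ?_
      rw [Set.uIcc_of_le Real.pi_pos.le] at hφ
      change 0 ≤ (circleMap (c : ℂ) R φ).im
      rw [circleMap_im]
      exact mul_nonneg hR.le (Real.sin_nonneg_of_mem_Icc hφ)
  have hup : ∀ θ ∈ Set.Icc 0 Real.pi, w θ = u θ := by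
    intro θ hθ
    simp only [hw, hu, continued]
    rw [if_pos]
    rw [circleMap_im]
    exact mul_nonneg hR.le (Real.sin_nonneg_of_mem_Icc hθ)
  have hwi1 : IntervalIntegrable w MeasureTheory.volume 0 Real.pi := by
    refine hui.congr fun θ hθ => ?_
    rw [Set.uIoc_of_le Real.pi_pos.le] at hθ
    exact (hup θ ⟨hθ.1.le, hθ.2⟩).symm
  have hlow : ∀ θ ∈ Set.Ioo 0 Real.pi,
      w (2 * Real.pi - θ) = -((-1 : ℂ) ^ N * (starRingEnd ℂ) (u θ)) := by
    intro θ hθ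
    have hpos : 0 < (circleMap (c : ℂ) R θ).im := by
      rw [circleMap_im]
      exact mul_pos hR (Real.sin_pos_of_mem_Ioo hθ)
    simp only [hw, hu, continued, deriv_circleMap]
    rw [circleMap_two_pi_sub, if_neg (by simpa using hpos), S.integrand_conj hpos.ne', map_mul,
      map_mul, Complex.conj_I]
    have : circleMap 0 R (2 * Real.pi - θ) = (starRingEnd ℂ) (circleMap 0 R θ) := by
      simpa using circleMap_two_pi_sub 0 R θ
    rw [this]
    ring
  have hconj : IntervalIntegrable (fun θ => -((-1 : ℂ) ^ N * (starRingEnd ℂ) (u θ)))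
      MeasureTheory.volume 0 Real.pi := by
    refine (IntervalIntegrable.const_mul ?_ _).neg
    rw [intervalIntegrable_iff] at hui ⊢
    exact Complex.conjCLE.toContinuousLinearMap.integrable_comp hui
  have hae : ∀ᵐ θ : ℝ, θ ∈ Set.uIoc 0 Real.pi →
      w (2 * Real.pi - θ) = -((-1 : ℂ) ^ N * (starRingEnd ℂ) (u θ)) := by
    filter_upwards [MeasureTheory.Measure.ae_ne MeasureTheory.volume Real.pi] with θ hθ hθI
    rw [Set.uIoc_of_le Real.pi_pos.le] at hθI
    exact hlow θ ⟨hθI.1, lt_of_le_of_ne hθI.2 hθ⟩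
  have hwi2' : IntervalIntegrable (fun θ => w (2 * Real.pi - θ)) MeasureTheory.volume 0
      Real.pi := by
    refine hconj.congr_ae ?_
    rw [Filter.EventuallyEq, MeasureTheory.ae_restrict_iff' measurableSet_uIoc]
    filter_upwards [hae] with θ h1 h2 using (h1 h2).symm
  have hwi2 : IntervalIntegrable w MeasureTheory.volume Real.pi (2 * Real.pi) := by
    have h := (hwi2'.comp_sub_left (2 * Real.pi)).symm
    simp only [sub_sub_cancel, sub_zero] at h
    rwa [show 2 * Real.pi - Real.pi = Real.pi by ring] at h
  have e2 : ∫ θ in Real.pi..(2 * Real.pi), w θ =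
      -((-1 : ℂ) ^ N * (starRingEnd ℂ) (∫ θ in (0 : ℝ)..Real.pi, u θ)) := by
    have h := intervalIntegral.integral_comp_sub_left (a := 0) (b := Real.pi) w (2 * Real.pi)
    rw [sub_zero, show 2 * Real.pi - Real.pi = Real.pi by ring] at h
    rw [← h, intervalIntegral.integral_congr_ae hae, intervalIntegral.integral_neg,
      intervalIntegral.integral_const_mul, intervalIntegral.intervalIntegral_eq_integral_uIoc,
      intervalIntegral.intervalIntegral_eq_integral_uIoc, if_pos Real.pi_pos.le, one_smul, one_smul,
      integral_conj]
  have e1 : ∫ θ in (0 : ℝ)..Real.pi, w θ = ∫ θ in (0 : ℝ)..Real.pi, u θ := by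
    refine intervalIntegral.integral_congr fun θ hθ => ?_
    rw [Set.uIcc_of_le Real.pi_pos.le] at hθ
    exact hup θ hθ
  have e0 : (∮ z in C(c, R), S.continued q z) = ∫ θ in (0 : ℝ)..(2 * Real.pi), w θ := rfl
  rw [e0, ← intervalIntegral.integral_add_adjacent_intervals hwi1 hwi2, e1, e2]
  ring

end SCData

theorem Complex.I_zpow_sum {ι : Type*} (s : Finset ι) (f : ι → ℤ) :
    ∏ k ∈ s, Complex.I ^ f k = Complex.I ^ ∑ k ∈ s, f k := by
  classical
  induction s using Finset.induction_on with
  | empty => simp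
  | insert k s hk ih =>
    rw [Finset.prod_insert hk, Finset.sum_insert hk, ih, zpow_add₀ Complex.I_ne_zero]

theorem Complex.conj_I_zpow (m : ℤ) :
    (starRingEnd ℂ) (Complex.I ^ m) = (-1) ^ m * Complex.I ^ m := by
  rw [map_zpow₀, Complex.conj_I, ← mul_zpow, neg_one_mul]

theorem Complex.norm_I_zpow (m : ℤ) : ‖Complex.I ^ m‖ = 1 := by
  rw [norm_zpow, Complex.norm_I, one_zpow]

theorem Complex.ofReal_neg_cpow_half_int {x : ℝ} (hx : x < 0) (m : ℤ) :
    (x : ℂ) ^ ((m : ℂ) / 2) = Complex.I ^ m * ((|x| ^ ((m : ℝ) / 2) : ℝ) : ℂ) := by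
  rw [Complex.ofReal_cpow_of_nonpos hx.le, abs_of_neg hx, Complex.ofReal_cpow (by linarith),
    mul_comm]
  congr 1
  · rw [show (Real.pi : ℂ) * Complex.I * ((m : ℂ) / 2) = m * (Real.pi / 2 * Complex.I) by ring,
      Complex.exp_int_mul, Complex.exp_pi_div_two_mul_I]
  · push_cast
    rfl

theorem Complex.ofReal_pos_cpow_half_int {x : ℝ} (hx : 0 < x) (m : ℤ) :
    (x : ℂ) ^ ((m : ℂ) / 2) = ((|x| ^ ((m : ℝ) / 2) : ℝ) : ℂ) := by
  rw [abs_of_pos hx, Complex.ofReal_cpow hx.le]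
  push_cast
  rfl

namespace SCData

variable {n : ℕ}

/-- The real number `x` lies on the edge number `k`. -/
def OnEdge (S : SCData n) (k : ℕ) (x : ℝ) : Prop :=
  ∀ l ∈ Finset.Icc 1 n, (l ≤ k → S.t l < x) ∧ (k < l → x < S.t l)

theorem OnEdge.lt_iff {S : SCData n} {k : ℕ} {x : ℝ} (h : S.OnEdge k x) {l : ℕ}
    (hl : l ∈ Finset.Icc 1 n) : S.t l < x ↔ l ≤ k :=
  ⟨fun h1 => by
    by_contra h2
    exact lt_asymm h1 ((h l hl).2 (not_le.1 h2)), (h l hl).1⟩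

theorem OnEdge.ne {S : SCData n} {k : ℕ} {x : ℝ} (h : S.OnEdge k x) {l : ℕ}
    (hl : l ∈ Finset.Icc 1 n) : S.t l ≠ x := by
  rcases le_or_gt l k with h1 | h1
  · exact ((h l hl).1 h1).ne
  · exact ((h l hl).2 h1).ne.symm

/-- The argument of the integrand is constant on each edge. -/
theorem OnEdge.integrand_eq {S : SCData n} {k : ℕ} {x : ℝ} (h : S.OnEdge k x) :
    S.integrand x = Complex.I ^ (∑ l ∈ Finset.Ioc k n, S.a l) * (‖S.integrand x‖ : ℂ) := by
  rw [norm_integrand_ofReal, integrand, ← Complex.I_zpow_sum]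
  have h1 : ∏ l ∈ Finset.Ioc k n, Complex.I ^ S.a l =
      ∏ l ∈ Finset.Icc 1 n, if k < l then Complex.I ^ S.a l else 1 := by
    rw [← Finset.prod_filter]
    refine Finset.prod_congr ?_ fun _ _ => rfl
    ext l
    simp only [Finset.mem_Ioc, Finset.mem_filter, Finset.mem_Icc]
    omega
  rw [h1, Complex.ofReal_prod, ← Finset.prod_mul_distrib]
  refine Finset.prod_congr rfl fun l hl => ?_
  rw [← Complex.ofReal_sub]
  split_ifs with hkl
  · exact Complex.ofReal_neg_cpow_half_int (sub_neg.2 ((h l hl).2 hkl)) _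
  · rw [one_mul]
    exact Complex.ofReal_pos_cpow_half_int (sub_pos.2 ((h l hl).1 (not_lt.1 hkl))) _

theorem exists_onEdge (S : SCData n) (hS : StrictMonoOn S.t (Set.Icc 1 n)) {x : ℝ}
    (hx : ∀ k ∈ Finset.Icc 1 n, x ≠ S.t k) : ∃ k ≤ n, S.OnEdge k x := by
  classical
  set k := Nat.findGreatest (fun l => 1 ≤ l ∧ S.t l < x) n with hk
  have hkn : k ≤ n := Nat.findGreatest_le n
  refine ⟨k, hkn, fun l hl => ⟨fun hlk => ?_, fun hkl => ?_⟩⟩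
  · have hl' := Finset.mem_Icc.1 hl
    have hk0 : k ≠ 0 := by omega
    have hP := Nat.findGreatest_of_ne_zero hk.symm hk0
    exact lt_of_le_of_lt (hS.monotoneOn ⟨hl'.1, hl'.2⟩ ⟨hP.1, hkn⟩ hlk) hP.2
  · have hl' := Finset.mem_Icc.1 hl
    have hn := Nat.findGreatest_is_greatest hkl hl'.2
    exact lt_of_le_of_ne (not_lt.1 fun h => hn ⟨hl'.1, h⟩) (hx l hl)

theorem onEdge_edgePoint (S : SCData n) (hS : StrictMonoOn S.t (Set.Icc 1 n)) {k : ℕ}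
    (hk : k ≤ n) : S.OnEdge k (S.edgePoint k) := by
  intro l hl
  have hl' := Finset.mem_Icc.1 hl
  have hm : ∀ {u v : ℕ}, 1 ≤ u → u ≤ v → v ≤ n → S.t u ≤ S.t v := fun h1 h2 h3 =>
    hS.monotoneOn ⟨h1, h2.trans h3⟩ ⟨h1.trans h2, h3⟩ h2
  unfold edgePoint
  split_ifs with h0 h1
  · refine ⟨fun h => by omega, fun _ => ?_⟩
    have := hm le_rfl hl'.1 hl'.2
    linarith
  · refine ⟨fun _ => ?_, fun h => by omega⟩
    have := hm hl'.1 hl'.2 le_rfl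
    linarith
  · have hlt : S.t k < S.t (k + 1) :=
      hS ⟨by omega, by omega⟩ ⟨by omega, by omega⟩ (Nat.lt_succ_self k)
    refine ⟨fun h => ?_, fun h => ?_⟩
    · have := hm hl'.1 h hk
      linarith
    · have := hm (by omega) h hl'.2
      simp only [Nat.succ_eq_add_one] at this
      linarith

/-- The union of the edges number `p + 1, p + 3, …` below edge number `q`. -/
def oddEdges (S : SCData n) (p q : ℕ) : Set ℝ :=
  {x | ∃ k, p < k ∧ k < q ∧ Odd (k + p) ∧ S.t k < x ∧ x < S.t (k + 1)}

theorem isOpen_oddEdges (S : SCData n) (p q : ℕ) : IsOpen (S.oddEdges p q) := by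
  have : S.oddEdges p q =
      ⋃ k ∈ {k | p < k ∧ k < q ∧ Odd (k + p)}, Set.Ioo (S.t k) (S.t (k + 1)) := by
    ext x
    simp only [oddEdges, Set.mem_ofPred_eq, Set.mem_iUnion, Set.mem_Ioo, exists_prop, and_assoc]
  rw [this]
  exact isOpen_biUnion fun _ _ => isOpen_Ioo

theorem OnEdge.mem_oddEdges_iff {S : SCData n} {k p q : ℕ} {x : ℝ} (h : S.OnEdge k x)
    (hpk : p ≤ k) (hkq : k ≤ q) (hq : q ≤ n) (hpq : Even (p + q)) :
    x ∈ S.oddEdges p q ↔ Odd (k + p) := by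
  constructor
  · rintro ⟨l, hpl, hlq, hl, h1, h2⟩
    have h3 := (h.lt_iff (Finset.mem_Icc.2 ⟨by omega, by omega⟩)).1 h1
    have h4 : ¬ l + 1 ≤ k := fun h5 =>
      lt_asymm h2 ((h (l + 1) (Finset.mem_Icc.2 ⟨by omega, by omega⟩)).1 h5)
    rwa [show k = l by omega]
  · intro hk
    rw [Nat.odd_iff] at hk
    rw [Nat.even_iff] at hpq
    refine ⟨k, by omega, by omega, by rwa [Nat.odd_iff], ?_, ?_⟩
    · exact (h k (Finset.mem_Icc.2 ⟨by omega, by omega⟩)).1 le_rfl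
    · exact (h (k + 1) (Finset.mem_Icc.2 ⟨by omega, by omega⟩)).2 (Nat.lt_succ_self k)

theorem AlternatesOn.apply_sub {S : SCData n} {p q : ℕ} (h : S.AlternatesOn (p + 1) q) {m : ℕ}
    (hm : p + m < q) : S.a (q - m) = if Even m then S.a q else -S.a q := by
  induction m with
  | zero => simp
  | succ m ih =>
    have h1 := ih (by omega)
    have h2 := h.2 (q - (m + 1)) (Finset.mem_Ico.2 ⟨by omega, by omega⟩)
    rw [show q - (m + 1) + 1 = q - m by omega, h1] at h2
    by_cases hm' : Even m
    · rw [if_pos hm'] at h2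
      rw [if_neg (by rw [Nat.even_add_one]; exact not_not.2 hm'), h2, neg_neg]
    · rw [if_neg hm'] at h2
      rw [if_pos (by rw [Nat.even_add_one]; exact hm')]
      exact (neg_injective h2).symm

theorem AlternatesOn.sum_Ioc_sub {S : SCData n} {p q : ℕ} (h : S.AlternatesOn (p + 1) q)
    (hq : q ≤ n) {m : ℕ} (hm : p + m ≤ q) :
    ∑ k ∈ Finset.Ioc (q - m) n, S.a k =
      ∑ k ∈ Finset.Ioc q n, S.a k + if Even m then 0 else S.a q := by
  induction m with
  | zero => simp
  | succ m ih =>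
    have h1 := ih (by omega)
    have h2 : Finset.Ioc (q - (m + 1)) n = insert (q - m) (Finset.Ioc (q - m) n) := by
      ext l
      simp only [Finset.mem_Ioc, Finset.mem_insert]
      omega
    rw [h2, Finset.sum_insert (by simp), h1, h.apply_sub (by omega)]
    by_cases hm' : Even m
    · rw [if_pos hm', if_pos hm', if_neg (by rw [Nat.even_add_one]; exact not_not.2 hm')]
      ring
    · rw [if_neg hm', if_neg hm', if_pos (by rw [Nat.even_add_one]; exact hm')]
      ring

theorem neg_one_zpow_mul_self (m : ℤ) : (-1 : ℂ) ^ m * (-1) ^ m = 1 := by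
  rw [← mul_zpow]
  simp

/-- The hypotheses under which the period of the arc from edge `p` to edge `q` is a sum of lengths
of parallel edges. -/
structure Staircase (S : SCData n) (p q : ℕ) : Prop where
  strictMonoOn : StrictMonoOn S.t (Set.Icc 1 n)
  lt : p < q
  le : q ≤ n
  even : Even (p + q)
  alternates : S.AlternatesOn (p + 1) q

theorem Staircase.integrand_sub_conj {S : SCData n} {p q : ℕ} (h : S.Staircase p q) {k : ℕ}
    {x : ℝ} (hx : S.OnEdge k x) (hpk : p ≤ k) (hkq : k ≤ q) :
    S.integrand x - (-1) ^ (∑ l ∈ Finset.Ioc q n, S.a l) * (starRingEnd ℂ) (S.integrand x) =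
      2 * Complex.I ^ (∑ l ∈ Finset.Ioc q n, S.a l + S.a q) *
        ((S.oddEdges p q).indicator (fun x => ‖S.integrand x‖) x : ℝ) := by
  have hsum := h.alternates.sum_Ioc_sub h.le (m := q - k) (by omega)
  rw [show q - (q - k) = k by omega] at hsum
  have heq := hx.integrand_eq
  have hmem := hx.mem_oddEdges_iff hpk hkq h.le h.even
  have heven := h.even
  have hpar : Even (q - k) ↔ ¬ Odd (k + p) := by
    rw [Nat.even_iff] at heven ⊢
    rw [Nat.odd_iff]
    omega
  set N := ∑ l ∈ Finset.Ioc q n, S.a l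
  by_cases hodd : Odd (k + p)
  · rw [Set.indicator_of_mem (hmem.2 hodd)]
    rw [if_neg (by rw [hpar]; exact not_not.2 hodd)] at hsum
    rw [hsum] at heq
    have ha : (-1 : ℂ) ^ S.a q = -1 := by
      rcases h.alternates.1 q (Finset.mem_Icc.2 ⟨h.lt, le_rfl⟩) with h1 | h1 <;> rw [h1] <;> simp
    have hc : (starRingEnd ℂ) (S.integrand x) =
        (-1) ^ (N + S.a q) * (Complex.I ^ (N + S.a q) * (‖S.integrand x‖ : ℂ)) := by
      conv_lhs => rw [heq]
      rw [map_mul, Complex.conj_I_zpow, Complex.conj_ofReal]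
      ring
    rw [hc]
    conv_lhs => enter [1]; rw [heq]
    rw [zpow_add₀ (by norm_num : (-1 : ℂ) ≠ 0), ha]
    linear_combination (Complex.I ^ (N + S.a q) * (‖S.integrand x‖ : ℂ)) * neg_one_zpow_mul_self N
  · rw [Set.indicator_of_notMem (fun h1 => hodd (hmem.1 h1))]
    rw [if_pos (hpar.2 hodd), add_zero] at hsum
    rw [hsum] at heq
    have hc : (starRingEnd ℂ) (S.integrand x) =
        (-1) ^ N * (Complex.I ^ N * (‖S.integrand x‖ : ℂ)) := by
      conv_lhs => rw [heq]
      rw [map_mul, Complex.conj_I_zpow, Complex.conj_ofReal]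
      ring
    rw [hc]
    conv_lhs => enter [1]; rw [heq]
    simp only [Complex.ofReal_zero, mul_zero]
    linear_combination -(Complex.I ^ N * (‖S.integrand x‖ : ℂ)) * neg_one_zpow_mul_self N

theorem Staircase.edgePoint_lt {S : SCData n} {p q : ℕ} (h : S.Staircase p q) :
    S.edgePoint p < S.edgePoint q := by
  have h1 := S.onEdge_edgePoint h.strictMonoOn (h.lt.le.trans h.le)
  have h2 := S.onEdge_edgePoint h.strictMonoOn h.le
  have hq : q ∈ Finset.Icc 1 n := Finset.mem_Icc.2 ⟨by have := h.lt; omega, h.le⟩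
  exact ((h1 q hq).2 h.lt).trans ((h2 q hq).1 le_rfl)

theorem Staircase.oddEdges_subset {S : SCData n} {p q : ℕ} (h : S.Staircase p q) :
    S.oddEdges p q ⊆ Set.Ioc (S.edgePoint p) (S.edgePoint q) := by
  rintro x ⟨k, hpk, hkq, -, h1, h2⟩
  have hqn := h.le
  have e1 := S.onEdge_edgePoint h.strictMonoOn (h.lt.le.trans h.le)
  have e2 := S.onEdge_edgePoint h.strictMonoOn h.le
  exact ⟨((e1 k (Finset.mem_Icc.2 ⟨by omega, by omega⟩)).2 hpk).trans h1,
    (h2.trans ((e2 (k + 1) (Finset.mem_Icc.2 ⟨by omega, by omega⟩)).1 hkq)).le⟩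

theorem Staircase.vertex_between {S : SCData n} {p q : ℕ} (h : S.Staircase p q) :
    ∀ k ∈ Finset.Icc 1 n, S.t k ∈ Set.Icc (S.edgePoint p) (S.edgePoint q) →
      -2 < S.a k ∧ ∀ l ∈ Finset.Icc 1 n, S.t l = S.t k → l = k := by
  intro k hk hkI
  have hinj := h.strictMonoOn.injOn
  refine ⟨?_, fun l hl hlk => hinj (by simpa using hl) (by simpa using hk) hlk⟩
  have e1 := S.onEdge_edgePoint h.strictMonoOn (h.lt.le.trans h.le)
  have e2 := S.onEdge_edgePoint h.strictMonoOn h.le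
  have h1 : p < k := by
    by_contra hc
    exact not_lt.2 hkI.1 ((e1 k hk).1 (not_lt.1 hc))
  have h2 : k ≤ q := by
    by_contra hc
    exact not_lt.2 hkI.2 ((e2 k hk).2 (not_le.1 hc))
  rcases h.alternates.1 k (Finset.mem_Icc.2 ⟨h1, h2⟩) with h3 | h3 <;> rw [h3] <;> norm_num

open MeasureTheory in
theorem Staircase.integrableOn_norm {S : SCData n} {p q : ℕ} (h : S.Staircase p q) :
    IntegrableOn (fun x : ℝ => ‖S.integrand x‖)
      (Set.Icc (S.edgePoint p) (S.edgePoint q)) :=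
  S.integrableOn_norm_integrand isCompact_Icc h.vertex_between

open MeasureTheory in
/-- The period as a multiple of the total length of the edges it crosses. -/
theorem Staircase.period_eq {S : SCData n} {p q : ℕ} (h : S.Staircase p q) :
    S.period p q = -Complex.I ^ (∑ l ∈ Finset.Ioc q n, S.a l + S.a q) *
      ((∫ x in S.oddEdges p q, ‖S.integrand x‖ : ℝ) : ℂ) := by
  have e1 := S.onEdge_edgePoint h.strictMonoOn (h.lt.le.trans h.le)
  have e2 := S.onEdge_edgePoint h.strictMonoOn h.le
  have hlt := h.edgePoint_lt
  set x₀ := S.edgePoint p with hx₀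
  set x₁ := S.edgePoint q with hx₁
  set N := ∑ l ∈ Finset.Ioc q n, S.a l
  have hc1 : (x₀ + x₁) / 2 - (x₁ - x₀) / 2 = x₀ := by ring
  have hc2 : (x₀ + x₁) / 2 + (x₁ - x₀) / 2 = x₁ := by ring
  have hR : 0 < (x₁ - x₀) / 2 := by linarith
  have hne : ∀ k ∈ Finset.Icc 1 n, S.t k ≠ (x₀ + x₁) / 2 - (x₁ - x₀) / 2 ∧
      S.t k ≠ (x₀ + x₁) / 2 + (x₁ - x₀) / 2 := by
    rw [hc1, hc2]
    exact fun k hk => ⟨e1.ne hk, e2.ne hk⟩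
  have hU := S.integral_upper_arc_integrand ((x₀ + x₁) / 2) ((x₁ - x₀) / 2) hR hne
    (by rw [hc1, hc2]; exact h.vertex_between)
  rw [period, S.circleIntegral_continued q _ _ hR hne, hU, hc1, hc2]
  have hpt : ∀ᵐ x : ℝ, x ∈ Set.uIoc x₀ x₁ →
      S.integrand x - (-1) ^ N * (starRingEnd ℂ) (S.integrand x) =
      2 * Complex.I ^ (N + S.a q) *
        ((S.oddEdges p q).indicator (fun x => ‖S.integrand x‖) x : ℝ) := by
    filter_upwards [S.ae_ne_vertex] with x hx hxI
    rw [Set.uIoc_of_le hlt.le] at hxI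
    obtain ⟨k, hkn, hk⟩ := S.exists_onEdge h.strictMonoOn hx
    refine h.integrand_sub_conj hk ?_ ?_
    · rcases Nat.eq_zero_or_pos p with h0 | h0
      · omega
      · have hp : p ∈ Finset.Icc 1 n := Finset.mem_Icc.2 ⟨h0, h.lt.le.trans h.le⟩
        exact (hk.lt_iff hp).1 (((e1 p hp).1 le_rfl).trans hxI.1)
    · by_contra hc
      have hk' : k ∈ Finset.Icc 1 n := Finset.mem_Icc.2 ⟨by omega, hkn⟩
      exact lt_asymm ((hk k hk').1 le_rfl) (lt_of_le_of_lt hxI.2 ((e2 k hk').2 (not_le.1 hc)))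
  have hint : IntervalIntegrable (fun x : ℝ => S.integrand x) volume x₀ x₁ := by
    rw [intervalIntegrable_iff_integrableOn_Icc_of_le hlt.le]
    refine (integrable_norm_iff ?_).1 h.integrableOn_norm
    refine Measurable.aestronglyMeasurable ?_
    unfold integrand
    fun_prop
  have hint' : IntervalIntegrable (fun x : ℝ => (starRingEnd ℂ) (S.integrand x)) volume x₀ x₁ := by
    rw [intervalIntegrable_iff] at hint ⊢
    exact Complex.conjCLE.toContinuousLinearMap.integrable_comp hint
  have hconj : (starRingEnd ℂ) (∫ x in x₀..x₁, S.integrand x) =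
      ∫ x in x₀..x₁, (starRingEnd ℂ) (S.integrand x) := by
    rw [intervalIntegral.integral_of_le hlt.le, intervalIntegral.integral_of_le hlt.le,
      integral_conj]
  have hI : (∫ x in x₀..x₁, S.integrand x) - (-1) ^ N *
      (starRingEnd ℂ) (∫ x in x₀..x₁, S.integrand x) = 2 * Complex.I ^ (N + S.a q) *
      ((∫ x in S.oddEdges p q, ‖S.integrand x‖ : ℝ) : ℂ) := by
    rw [hconj, ← intervalIntegral.integral_const_mul,
      ← intervalIntegral.integral_sub hint (hint'.const_mul _),
      intervalIntegral.integral_congr_ae hpt, intervalIntegral.integral_const_mul,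
      intervalIntegral.integral_ofReal, intervalIntegral.integral_of_le hlt.le,
      setIntegral_indicator (S.isOpen_oddEdges p q).measurableSet,
      Set.inter_eq_self_of_subset_right h.oddEdges_subset]
  rw [map_neg]
  linear_combination (-1 / 2 : ℂ) * hI

open MeasureTheory in
theorem Staircase.integral_pos {S : SCData n} {p q : ℕ} (h : S.Staircase p q) :
    0 < ∫ x in S.oddEdges p q, ‖S.integrand x‖ := by
  have hlt := h.lt
  have hle := h.le
  have heven := Nat.even_iff.1 h.even
  rw [setIntegral_pos_iff_support_of_nonneg_ae]
  · have hsub : Set.Ioo (S.t (p + 1)) (S.t (p + 2)) ⊆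
        (Function.support fun x : ℝ => ‖S.integrand x‖) ∩ S.oddEdges p q := by
      intro x hx
      refine ⟨?_, p + 1, by omega, by omega, by rw [Nat.odd_iff]; omega, hx.1, hx.2⟩
      rw [Function.mem_support, norm_ne_zero_iff]
      refine S.integrand_ne_zero fun k hk hxk => ?_
      have hxk' : x = S.t k := by exact_mod_cast hxk
      have hk' : k ∈ Set.Icc 1 n := by simpa using hk
      have m1 := (h.strictMonoOn.lt_iff_lt (a := p + 1) (b := k) ⟨by omega, by omega⟩ hk').1
        (hxk' ▸ hx.1)
      have m2 := (h.strictMonoOn.lt_iff_lt (a := k) (b := p + 2) hk' ⟨by omega, by omega⟩).1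
        (hxk' ▸ hx.2)
      omega
    refine lt_of_lt_of_le ?_ (measure_mono hsub)
    rw [Real.volume_Ioo, ENNReal.ofReal_pos, sub_pos]
    exact h.strictMonoOn ⟨by omega, by omega⟩ ⟨by omega, by omega⟩ (by omega)
  · exact Eventually.of_forall fun x => norm_nonneg _
  · exact h.integrableOn_norm.mono_set (h.oddEdges_subset.trans Set.Ioc_subset_Icc_self)

theorem Staircase.norm_period {S : SCData n} {p q : ℕ} (h : S.Staircase p q) :
    ‖S.period p q‖ = ∫ x in S.oddEdges p q, ‖S.integrand x‖ := by
  rw [h.period_eq, norm_mul, norm_neg, Complex.norm_I_zpow, one_mul, Complex.norm_real,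
    Real.norm_of_nonneg h.integral_pos.le]

end SCData

open Complex MeasureTheory in
/-- The Cauchy theorem for a rectangle, for a function with real values on three of its sides. -/
theorem integral_bottom_of_real_on_three_sides {G : ℂ → ℂ} {s : ℝ} (hs : 0 ≤ s)
    (hG : DifferentiableOn ℂ G (Set.Icc 0 s ×ℂ Set.Icc 0 Real.pi))
    (hbot : ∀ x ∈ Set.Icc 0 s, (G (x : ℂ)).im = 0)
    (htop : ∀ x ∈ Set.Icc 0 s, (G (x + Real.pi * I)).im = 0)
    (hleft : ∀ φ ∈ Set.Icc 0 Real.pi, (G (φ * I)).im = 0) :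
    Real.pi * ∫ x in (0 : ℝ)..s, (G (x : ℂ)).re =
      s * (∫ φ in (0 : ℝ)..Real.pi, (G (φ * I)).re) +
        (∫ φ in (0 : ℝ)..Real.pi, ((Real.pi - φ : ℝ) : ℂ) * G (s + φ * I)).im := by
  have hpi := Real.pi_pos.le
  have hright : IntervalIntegrable (fun φ : ℝ => G (s + φ * I)) volume 0 Real.pi := by
    refine (hG.continuousOn.comp (by fun_prop) fun φ hφ => ?_).intervalIntegrable
    rw [Set.uIcc_of_le hpi] at hφ
    simp only [mem_reProdIm, add_re, ofReal_re, mul_re, I_re, mul_zero, ofReal_im, I_im, mul_one,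
      sub_self, add_zero, add_im, mul_im, zero_add]
    exact ⟨⟨hs, le_rfl⟩, hφ⟩
  have hbotI : IntervalIntegrable (fun x : ℝ => G x) volume 0 s := by
    refine (hG.continuousOn.comp (by fun_prop) fun x hx => ?_).intervalIntegrable
    rw [Set.uIcc_of_le hs] at hx
    simp only [mem_reProdIm, ofReal_re, ofReal_im]
    exact ⟨hx, le_rfl, hpi⟩
  have hre : ∀ {z : ℂ}, z.im = 0 → z = (z.re : ℂ) := fun h => by
    apply Complex.ext <;> simp [h]
  have e1 : ∫ x in (0 : ℝ)..s, G x = ((∫ x in (0 : ℝ)..s, (G x).re : ℝ) : ℂ) := by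
    rw [← intervalIntegral.integral_ofReal]
    refine intervalIntegral.integral_congr fun x hx => ?_
    rw [Set.uIcc_of_le hs] at hx
    exact hre (hbot x hx)
  have e2 : ∫ x in (0 : ℝ)..s, G (x + Real.pi * I) =
      ((∫ x in (0 : ℝ)..s, (G (x + Real.pi * I)).re : ℝ) : ℂ) := by
    rw [← intervalIntegral.integral_ofReal]
    refine intervalIntegral.integral_congr fun x hx => ?_
    rw [Set.uIcc_of_le hs] at hx
    exact hre (htop x hx)
  have e3 : ∫ φ in (0 : ℝ)..Real.pi, G (φ * I) =
      ((∫ φ in (0 : ℝ)..Real.pi, (G (φ * I)).re : ℝ) : ℂ) := by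
    rw [← intervalIntegral.integral_ofReal]
    refine intervalIntegral.integral_congr fun x hx => ?_
    rw [Set.uIcc_of_le hpi] at hx
    exact hre (hleft x hx)
  have e4 : ∫ x in (0 : ℝ)..s, (x - Real.pi * I) * G x =
      ((∫ x in (0 : ℝ)..s, x * (G x).re : ℝ) : ℂ) -
        Real.pi * I * ((∫ x in (0 : ℝ)..s, (G x).re : ℝ) : ℂ) := by
    rw [← e1, ← intervalIntegral.integral_ofReal, ← intervalIntegral.integral_const_mul,
      ← intervalIntegral.integral_sub]
    · refine intervalIntegral.integral_congr fun x hx => ?_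
      rw [Set.uIcc_of_le hs] at hx
      rw [ofReal_mul, ← hre (hbot x hx)]
      ring
    · have h := hbotI.continuousOn_mul (g := fun x : ℝ => (x : ℂ)) (by fun_prop)
      refine h.congr fun x hx => ?_
      rw [Set.uIoc_of_le hs] at hx
      rw [ofReal_mul, ← hre (hbot x ⟨hx.1.le, hx.2⟩)]
    · exact hbotI.const_mul _
  have e5 : ∫ x in (0 : ℝ)..s, (x + Real.pi * I - Real.pi * I) * G (x + Real.pi * I) =
      ((∫ x in (0 : ℝ)..s, x * (G (x + Real.pi * I)).re : ℝ) : ℂ) := by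
    rw [← intervalIntegral.integral_ofReal]
    refine intervalIntegral.integral_congr fun x hx => ?_
    rw [Set.uIcc_of_le hs] at hx
    rw [ofReal_mul, ← hre (htop x hx)]
    ring
  have e6 : ∫ φ in (0 : ℝ)..Real.pi, (φ * I - Real.pi * I) * G (φ * I) =
      I * ((∫ φ in (0 : ℝ)..Real.pi, (φ - Real.pi) * (G (φ * I)).re : ℝ) : ℂ) := by
    rw [← intervalIntegral.integral_ofReal, ← intervalIntegral.integral_const_mul]
    refine intervalIntegral.integral_congr fun x hx => ?_
    rw [Set.uIcc_of_le hpi] at hx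
    rw [ofReal_mul, ← hre (hleft x hx), ofReal_sub]
    ring
  have e7 : ∫ φ in (0 : ℝ)..Real.pi, (s + φ * I - Real.pi * I) * G (s + φ * I) =
      s * (∫ φ in (0 : ℝ)..Real.pi, G (s + φ * I)) -
        I * ∫ φ in (0 : ℝ)..Real.pi, ((Real.pi - φ : ℝ) : ℂ) * G (s + φ * I) := by
    rw [← intervalIntegral.integral_const_mul, ← intervalIntegral.integral_const_mul,
      ← intervalIntegral.integral_sub]
    · refine intervalIntegral.integral_congr fun x _ => ?_
      simp only [ofReal_sub]
      ring
    · exact hright.const_mul _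
    · exact (hright.continuousOn_mul (g := fun φ : ℝ => ((Real.pi - φ : ℝ) : ℂ))
        (by fun_prop)).const_mul _
  have hrect : (Set.uIcc (0 : ℂ).re (s + Real.pi * I : ℂ).re ×ℂ
      Set.uIcc (0 : ℂ).im (s + Real.pi * I : ℂ).im) = Set.Icc 0 s ×ℂ Set.Icc 0 Real.pi := by
    simp [Set.uIcc_of_le hs, Set.uIcc_of_le hpi]
  have c1 := integral_boundary_rect_eq_zero_of_differentiableOn G 0 (s + Real.pi * I)
    (by rw [hrect]; exact hG)
  have c2 := integral_boundary_rect_eq_zero_of_differentiableOn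
    (fun z => (z - Real.pi * I) * G z) 0 (s + Real.pi * I)
    (by rw [hrect]; exact (differentiableOn_id.sub_const _).mul hG)
  simp only [zero_re, zero_im, add_re, ofReal_re, mul_re, I_re, mul_zero, ofReal_im, I_im, mul_one,
      sub_self, add_zero, add_im, mul_im, zero_add, ofReal_zero, zero_mul, smul_eq_mul] at c1 c2
  rw [e1, e2, e3] at c1
  rw [e4, e5, e6, e7] at c2
  have c1' := congrArg Complex.im c1
  have c2' := congrArg Complex.im c2
  simp only [add_im, sub_im, mul_im, mul_re, ofReal_re, ofReal_im, I_re, I_im, sub_re,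
    zero_im] at c1' c2'
  linear_combination s * c1' - c2'

open MeasureTheory in
/-- Integrals of holomorphic functions of a parameter are holomorphic. -/
theorem analyticAt_integral_mul_of_bounded {α : Type*} [MeasurableSpace α] {μ : Measure α}
    {k : α → ℂ} {g : ℂ → α → ℂ} {r C : ℝ} (hr : 0 < r) (hk : Integrable k μ)
    (hmeas : ∀ δ ∈ Metric.ball (0 : ℂ) r, AEStronglyMeasurable (g δ) μ)
    (hdiff : ∀ᵐ x ∂μ, DifferentiableOn ℂ (fun δ => g δ x) (Metric.ball 0 r))
    (hbound : ∀ᵐ x ∂μ, ∀ δ ∈ Metric.ball (0 : ℂ) r, ‖g δ x‖ ≤ C) :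
    AnalyticAt ℂ (fun δ => ∫ x, k x * g δ x ∂μ) 0 := by
  suffices h : DifferentiableOn ℂ (fun δ => ∫ x, k x * g δ x ∂μ) (Metric.ball 0 (r / 2)) from
    h.analyticAt (Metric.ball_mem_nhds _ (by linarith))
  intro δ₀ hδ₀
  rw [mem_ball_zero_iff] at hδ₀
  have hsub : ∀ δ ∈ Metric.ball δ₀ (r / 4), Metric.closedBall δ (r / 8) ⊆ Metric.ball 0 r := by
    intro δ hδ z hz
    rw [Metric.mem_ball, dist_eq_norm] at hδ
    rw [Metric.mem_closedBall, dist_eq_norm] at hz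
    rw [mem_ball_zero_iff]
    calc ‖z‖ = ‖(z - δ) + (δ - δ₀) + δ₀‖ := by ring_nf
      _ ≤ ‖z - δ‖ + ‖δ - δ₀‖ + ‖δ₀‖ := norm_add₃_le
      _ < r := by linarith
  have hsub' : Metric.ball δ₀ (r / 4) ⊆ Metric.ball 0 r := fun δ hδ =>
    hsub δ hδ (Metric.mem_closedBall_self (by linarith))
  have hnhds : Metric.ball δ₀ (r / 4) ∈ 𝓝 δ₀ := Metric.ball_mem_nhds _ (by linarith)
  have hd : ∀ᵐ x ∂μ, ∀ δ ∈ Metric.ball δ₀ (r / 4),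
      HasDerivAt (fun δ => g δ x) (deriv (fun δ => g δ x) δ) δ := by
    filter_upwards [hdiff] with x hx δ hδ
    exact (hx.differentiableAt (Metric.isOpen_ball.mem_nhds (hsub' hδ))).hasDerivAt
  have hmeas' : AEStronglyMeasurable (fun x => deriv (fun δ => g δ x) δ₀) μ := by
    set u : ℕ → ℂ := fun m => ((1 / ((m : ℝ) + 1) : ℝ) : ℂ) with hu
    have hu0 : Tendsto u atTop (𝓝 0) := by
      have := (Complex.continuous_ofReal.tendsto 0).comp
        (tendsto_one_div_add_atTop_nhds_zero_nat (𝕜 := ℝ))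
      simpa [hu, Function.comp_def] using this
    have hune : ∀ m, u m ≠ 0 := fun m => by
      simp only [hu]
      exact_mod_cast (by positivity : (1 / ((m : ℝ) + 1) : ℝ) ≠ 0)
    have hball : ∀ᶠ m in atTop, δ₀ + u m ∈ Metric.ball (0 : ℂ) r := by
      have : Tendsto (fun m => δ₀ + u m) atTop (𝓝 δ₀) := by
        simpa using tendsto_const_nhds.add hu0
      exact (this.eventually hnhds).mono fun m hm => hsub' hm
    obtain ⟨m₀, hm₀⟩ := eventually_atTop.1 hball
    refine aestronglyMeasurable_of_tendsto_ae atTop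
      (f := fun m x => (u (m + m₀))⁻¹ • (g (δ₀ + u (m + m₀)) x - g δ₀ x)) (fun m => ?_) ?_
    · have h := (hmeas _ (hm₀ (m + m₀) (Nat.le_add_left _ _))).sub
        (hmeas _ (hsub' (Metric.mem_ball_self (by linarith))))
      exact h.const_smul (u (m + m₀))⁻¹
    · filter_upwards [hd] with x hx
      have h1 := (hx δ₀ (Metric.mem_ball_self (by linarith))).tendsto_slope_zero
      refine h1.comp (tendsto_nhdsWithin_iff.2
        ⟨hu0.comp (tendsto_add_atTop_nat m₀), Eventually.of_forall fun m => hune _⟩)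
  have hcont : ∀ᶠ δ in 𝓝 δ₀, AEStronglyMeasurable (fun x => k x * g δ x) μ := by
    filter_upwards [hnhds] with δ hδ
    exact hk.aestronglyMeasurable.mul (hmeas δ (hsub' hδ))
  have main := hasDerivAt_integral_of_dominated_loc_of_deriv_le (μ := μ) (𝕜 := ℂ)
    (F := fun δ x => k x * g δ x) (F' := fun δ x => k x * deriv (fun δ => g δ x) δ)
    (x₀ := δ₀) (s := Metric.ball δ₀ (r / 4)) (bound := fun x => ‖k x‖ * (C / (r / 8))) hnhds hcont
    (hk.mul_bdd (c := C) (hmeas _ (hsub' (Metric.mem_ball_self (by linarith)))) (by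
      filter_upwards [hbound] with x hx
      exact hx _ (hsub' (Metric.mem_ball_self (by linarith)))))
    (hk.aestronglyMeasurable.mul hmeas') (by
      filter_upwards [hdiff, hbound] with x hx hb δ hδ
      rw [norm_mul]
      gcongr
      refine Complex.norm_deriv_le_of_forall_mem_sphere_norm_le (by linarith) ?_ ?_
      · refine DifferentiableOn.diffContOnCl ?_
        rw [closure_ball _ (by linarith : r / 8 ≠ 0)]
        exact hx.mono (hsub δ hδ)
      · exact fun z hz => hb z (hsub δ hδ (Metric.sphere_subset_closedBall hz)))
    (hk.norm.mul_const _) (by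
      filter_upwards [hd] with x hx δ hδ
      exact (hx δ hδ).const_mul _)
  exact main.2.differentiableAt.differentiableWithinAt

theorem Complex.norm_cosh_le (z : ℂ) : ‖Complex.cosh z‖ ≤ Real.cosh z.re := by
  rw [Complex.cosh, norm_div, Real.cosh_eq, Complex.norm_ofNat]
  gcongr
  refine (norm_add_le _ _).trans ?_
  rw [Complex.norm_exp, Complex.norm_exp, Complex.neg_re]

theorem one_lt_two_mul_sub_div {L σ δ : ℝ} (hσ : σ = 1 ∨ σ = -1) (hδ : 0 < δ) (hδL : δ < L) :
    1 < (2 * L - σ * δ) / δ := by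
  rw [lt_div_iff₀ hδ]
  rcases hσ with rfl | rfl <;> linarith

/-- The point `(δ/2) cosh (s + iφ)` where `cosh s = (2L - σδ)/δ`. -/
noncomputable def ellipsePoint (L σ : ℝ) (δ : ℂ) (φ : ℝ) : ℂ :=
  (L - σ * δ / 2) * Real.cos φ + Complex.I * (L ^ 2 - σ * L * δ) ^ (1 / 2 : ℂ) * Real.sin φ

theorem half_mul_cosh_eq_ellipsePoint {L σ δ : ℝ} (hσ : σ = 1 ∨ σ = -1) (hδ : 0 < δ)
    (hδL : δ < L) (φ : ℝ) :
    (δ : ℂ) / 2 * Complex.cosh (Real.arcosh ((2 * L - σ * δ) / δ) + φ * Complex.I) =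
      ellipsePoint L σ δ φ := by
  have h1 := (one_lt_two_mul_sub_div hσ hδ hδL).le
  have hσ2 : σ ^ 2 = 1 := by rcases hσ with rfl | rfl <;> norm_num
  have hnn : 0 ≤ L ^ 2 - σ * L * δ := by rcases hσ with rfl | rfl <;> nlinarith
  have hsq : √(((2 * L - σ * δ) / δ) ^ 2 - 1) = 2 / δ * √(L ^ 2 - σ * L * δ) := by
    rw [show ((2 * L - σ * δ) / δ) ^ 2 - 1 = (2 / δ) ^ 2 * (L ^ 2 - σ * L * δ) by
      field_simp
      linear_combination δ ^ 2 * hσ2, Real.sqrt_mul (by positivity),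
      Real.sqrt_sq (by positivity)]
  rw [Complex.cosh_add, Complex.cosh_mul_I, Complex.sinh_mul_I, ← Complex.ofReal_cosh,
    ← Complex.ofReal_sinh, Real.cosh_arcosh h1, Real.sinh_arcosh h1, hsq, ellipsePoint]
  have h2 : ((L : ℂ) ^ 2 - σ * L * δ) ^ (1 / 2 : ℂ) = ((√(L ^ 2 - σ * L * δ) : ℝ) : ℂ) := by
    rw [Real.sqrt_eq_rpow, Complex.ofReal_cpow hnn]
    push_cast
    rfl
  rw [h2]
  push_cast
  have : (δ : ℂ) ≠ 0 := by exact_mod_cast hδ.ne'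
  field_simp

theorem norm_ellipsePoint_le {L σ : ℝ} {δ : ℂ} (hσ : σ = 1 ∨ σ = -1) (hL : 0 < L)
    (hδ : ‖δ‖ < L) (φ : ℝ) : ‖ellipsePoint L σ δ φ‖ ≤ 3 * L := by
  have hσ1 : |σ| = 1 := by rcases hσ with rfl | rfl <;> simp
  have hσn : ‖(σ : ℂ)‖ = 1 := by rw [Complex.norm_real, Real.norm_eq_abs, hσ1]
  have hLn : ‖(L : ℂ)‖ = L := by rw [Complex.norm_real, Real.norm_eq_abs, abs_of_pos hL]
  have h1 : ‖(L : ℂ) - σ * δ / 2‖ ≤ 3 / 2 * L := by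
    refine (norm_sub_le _ _).trans ?_
    rw [norm_div, norm_mul, hσn, hLn, Complex.norm_ofNat]
    linarith
  have h2 : ‖((L : ℂ) ^ 2 - σ * L * δ) ^ (1 / 2 : ℂ)‖ ≤ 3 / 2 * L := by
    have h3 : ‖(L : ℂ) ^ 2 - σ * L * δ‖ ≤ (3 / 2 * L) ^ 2 := by
      refine (norm_sub_le _ _).trans ?_
      rw [norm_pow, norm_mul, norm_mul, hσn, hLn]
      nlinarith [norm_nonneg δ]
    rw [show (1 / 2 : ℂ) = ((1 / 2 : ℝ) : ℂ) by push_cast; rfl, Complex.norm_cpow_real]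
    calc _ ≤ ((3 / 2 * L) ^ 2) ^ (1 / 2 : ℝ) := by gcongr
      _ = _ := by rw [← Real.sqrt_eq_rpow, Real.sqrt_sq (by positivity)]
  have hc : ‖(Real.cos φ : ℂ)‖ ≤ 1 := by
    rw [Complex.norm_real]; exact Real.abs_cos_le_one φ
  have hs : ‖(Real.sin φ : ℂ)‖ ≤ 1 := by
    rw [Complex.norm_real]; exact Real.abs_sin_le_one φ
  rw [ellipsePoint]
  refine (norm_add_le _ _).trans ?_
  rw [norm_mul, norm_mul, norm_mul, Complex.norm_I, one_mul]
  have e1 := mul_le_mul h1 hc (norm_nonneg _) (by positivity)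
  have e2 := mul_le_mul h2 hs (norm_nonneg _) (by positivity)
  linarith

theorem norm_half_add_ellipsePoint_le {L σ : ℝ} {δ : ℂ} (hσ : σ = 1 ∨ σ = -1) (hL : 0 < L)
    (hδ : ‖δ‖ < L) (φ : ℝ) : ‖δ / 2 + σ * ellipsePoint L σ δ φ‖ ≤ 7 / 2 * L := by
  have hσn : ‖(σ : ℂ)‖ = 1 := by
    rw [Complex.norm_real, Real.norm_eq_abs]
    rcases hσ with rfl | rfl <;> simp
  refine (norm_add_le _ _).trans ?_
  rw [norm_div, norm_mul, hσn, Complex.norm_ofNat]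
  linarith [norm_ellipsePoint_le hσ hL hδ φ]

theorem norm_half_mul_one_add_le {σ z : ℂ} {δ : ℂ} (hσ : ‖σ‖ = 1) (hz : ‖z‖ ≤ 1) :
    ‖δ / 2 * (1 + σ * z)‖ ≤ ‖δ‖ := by
  rw [norm_mul, norm_div, Complex.norm_ofNat]
  have : ‖1 + σ * z‖ ≤ 2 := by
    refine (norm_add_le _ _).trans ?_
    rw [norm_mul, hσ, norm_one]
    linarith
  nlinarith [norm_nonneg δ]

/-- The integral of `H` along the segment between two colliding vertices. -/
noncomputable def vanishingPeriod (H : ℂ → ℂ) (σ e : ℝ) (δ : ℂ) : ℂ :=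
  ∫ φ in (0 : ℝ)..Real.pi, δ / 2 * (Real.cos φ + e) * H (δ / 2 * (1 + σ * Real.cos φ))

/-- The contribution of the ellipse around two colliding vertices. -/
noncomputable def ellipseIntegral (H : ℂ → ℂ) (L σ e : ℝ) (δ : ℂ) : ℂ :=
  ∫ φ in (0 : ℝ)..Real.pi, ((Real.pi - φ : ℝ) : ℂ) *
    ((ellipsePoint L σ δ φ + e * δ / 2) * H (δ / 2 + σ * ellipsePoint L σ δ φ))

open Complex in
theorem integral_cosh_eq {H : ℂ → ℂ} {L σ δ : ℝ} (e : ℝ) (hσ : σ = 1 ∨ σ = -1) (hδ : 0 < δ)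
    (hδL : δ < L) (hH : DifferentiableOn ℂ H (Metric.ball 0 (4 * L)))
    (hreal : ∀ x : ℝ, |x| < 4 * L → (H x).im = 0) :
    Real.pi * ∫ s in (0 : ℝ)..Real.arcosh ((2 * L - σ * δ) / δ),
        δ / 2 * (Real.cosh s + e) * (H ((δ / 2 * (1 + σ * Real.cosh s) : ℝ) : ℂ)).re =
      Real.arcosh ((2 * L - σ * δ) / δ) * (vanishingPeriod H σ e δ).re +
        (ellipseIntegral H L σ e δ).im := by
  have h1 := one_lt_two_mul_sub_div hσ hδ hδL
  set S := Real.arcosh ((2 * L - σ * δ) / δ) with hS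
  have hcS : Real.cosh S = (2 * L - σ * δ) / δ := Real.cosh_arcosh h1.le
  have hS0 : 0 ≤ S := Real.arcosh_nonneg h1.le
  have hσn : ‖(σ : ℂ)‖ = 1 := by
    rw [Complex.norm_real, Real.norm_eq_abs]
    rcases hσ with rfl | rfl <;> simp
  have hδn : ‖(δ : ℂ)‖ = δ := by rw [Complex.norm_real, Real.norm_of_nonneg hδ.le]
  have hball : ∀ z : ℂ, ‖z‖ ≤ Real.cosh S → ‖(δ : ℂ) / 2 * (1 + σ * z)‖ < 4 * L := by
    intro z hz
    rw [norm_mul, norm_div, hδn, Complex.norm_ofNat]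
    have h2 : ‖1 + σ * z‖ ≤ 1 + Real.cosh S := by
      refine (norm_add_le _ _).trans ?_
      rw [norm_mul, hσn, norm_one]
      linarith
    have h3 : δ / 2 * (1 + Real.cosh S) < 4 * L := by
      rw [hcS, show δ / 2 * (1 + (2 * L - σ * δ) / δ) = δ / 2 + L - σ * δ / 2 by
        field_simp; ring]
      rcases hσ with rfl | rfl <;> linarith
    nlinarith
  set G : ℂ → ℂ := fun s => (δ : ℂ) / 2 * (cosh s + e) * H ((δ : ℂ) / 2 * (1 + σ * cosh s))
    with hG
  have hGreal : ∀ {s : ℂ} {y : ℝ}, cosh s = y → |y| ≤ Real.cosh S →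
      G s = ((δ / 2 * (y + e) * (H ((δ / 2 * (1 + σ * y) : ℝ) : ℂ)).re : ℝ) : ℂ) := by
    intro s y hy hyS
    have h2 := hball y (by rwa [Complex.norm_real])
    have h3 : (δ : ℂ) / 2 * (1 + σ * y) = ((δ / 2 * (1 + σ * y) : ℝ) : ℂ) := by push_cast; ring
    rw [h3, Complex.norm_real, Real.norm_eq_abs] at h2
    have h4 := hreal _ h2
    simp only [hG]
    rw [hy, h3, ← Complex.re_add_im (H ((δ / 2 * (1 + σ * y) : ℝ) : ℂ)), h4]
    push_cast
    simp
  have hcoshR : ∀ x ∈ Set.Icc 0 S, |Real.cosh x| ≤ Real.cosh S := by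
    intro x hx
    rw [abs_of_pos (Real.cosh_pos x), Real.cosh_le_cosh, abs_of_nonneg hx.1, abs_of_nonneg hS0]
    exact hx.2
  have hcosR : ∀ φ : ℝ, |Real.cos φ| ≤ Real.cosh S := fun φ =>
    (Real.abs_cos_le_one φ).trans (Real.one_le_cosh S)
  have hcoshpi : ∀ x : ℝ, cosh (x + Real.pi * I) = ((-Real.cosh x : ℝ) : ℂ) := by
    intro x
    rw [Complex.cosh_add, Complex.cosh_mul_I, Complex.sinh_mul_I, Complex.cos_pi, Complex.sin_pi]
    push_cast
    ring
  have hcosI : ∀ φ : ℝ, cosh (φ * I) = (Real.cos φ : ℂ) := fun φ => by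
    rw [Complex.cosh_mul_I, Complex.ofReal_cos]
  have key := integral_bottom_of_real_on_three_sides (G := G) hS0 ?_ ?_ ?_ ?_
  · have e1 : ∫ x in (0 : ℝ)..S, (G x).re = ∫ s in (0 : ℝ)..S,
        δ / 2 * (Real.cosh s + e) * (H ((δ / 2 * (1 + σ * Real.cosh s) : ℝ) : ℂ)).re := by
      refine intervalIntegral.integral_congr fun x hx => ?_
      rw [Set.uIcc_of_le hS0] at hx
      rw [hGreal (Complex.ofReal_cosh x).symm (hcoshR x hx), Complex.ofReal_re]
    have e2 : ((∫ φ in (0 : ℝ)..Real.pi, (G (φ * I)).re : ℝ) : ℂ) = vanishingPeriod H σ e δ := by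
      rw [← intervalIntegral.integral_ofReal, vanishingPeriod]
      refine intervalIntegral.integral_congr fun φ _ => ?_
      rw [hGreal (hcosI φ) (hcosR φ), Complex.ofReal_re, ← hGreal (hcosI φ) (hcosR φ)]
      simp only [hG]
      rw [hcosI]
    have e3 : ∫ φ in (0 : ℝ)..Real.pi, ((Real.pi - φ : ℝ) : ℂ) * G (S + φ * I) =
        ellipseIntegral H L σ e δ := by
      rw [ellipseIntegral]
      refine intervalIntegral.integral_congr fun φ _ => ?_
      simp only [hG]
      rw [← half_mul_cosh_eq_ellipsePoint hσ hδ hδL, ← hS]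
      ring_nf
    rw [← e1, ← e2, ← e3, Complex.ofReal_re]
    exact key
  · simp only [hG]
    refine DifferentiableOn.mul (by fun_prop) (hH.comp (by fun_prop) fun z hz => ?_)
    rw [mem_ball_zero_iff]
    refine hball _ ((Complex.norm_cosh_le z).trans ?_)
    have := hcoshR z.re hz.1
    rwa [abs_of_pos (Real.cosh_pos _)] at this
  · intro x hx
    rw [hGreal (Complex.ofReal_cosh x).symm (hcoshR x hx), Complex.ofReal_im]
  · intro x hx
    rw [hGreal (hcoshpi x) (by rw [abs_neg]; exact hcoshR x hx), Complex.ofReal_im]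
  · intro φ _
    rw [hGreal (hcosI φ) (hcosR φ), Complex.ofReal_im]

theorem exists_bound_of_differentiableOn_ball {H : ℂ → ℂ} {L : ℝ} (hL : 0 < L)
    (hH : DifferentiableOn ℂ H (Metric.ball 0 (4 * L))) :
    ∃ C, 0 ≤ C ∧ ∀ z : ℂ, ‖z‖ ≤ 7 / 2 * L → ‖H z‖ ≤ C := by
  have hsub : Metric.closedBall (0 : ℂ) (7 / 2 * L) ⊆ Metric.ball 0 (4 * L) :=
    Metric.closedBall_subset_ball (by linarith)
  obtain ⟨C, hC⟩ := (isCompact_closedBall (0 : ℂ) (7 / 2 * L)).exists_bound_of_continuousOn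
    (hH.continuousOn.mono hsub)
  exact ⟨C, (norm_nonneg _).trans (hC 0 (Metric.mem_closedBall_self (by positivity))),
    fun z hz => hC z (by rwa [mem_closedBall_zero_iff])⟩

theorem analyticAt_vanishingPeriod {H : ℂ → ℂ} {L σ : ℝ} (e : ℝ) (hσ : σ = 1 ∨ σ = -1)
    (hL : 0 < L) (hH : DifferentiableOn ℂ H (Metric.ball 0 (4 * L))) :
    AnalyticAt ℂ (vanishingPeriod H σ e) 0 := by
  obtain ⟨C, hC0, hC⟩ := exists_bound_of_differentiableOn_ball hL hH
  have hσn : ‖(σ : ℂ)‖ = 1 := by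
    rw [Complex.norm_real, Real.norm_eq_abs]
    rcases hσ with rfl | rfl <;> simp
  have hcos : ∀ φ : ℝ, ‖(Real.cos φ : ℂ)‖ ≤ 1 := fun φ => by
    rw [Complex.norm_real]; exact Real.abs_cos_le_one φ
  have h := analyticAt_integral_mul_of_bounded
    (μ := MeasureTheory.volume.restrict (Set.Ioc 0 Real.pi)) (k := fun _ => 1)
    (g := fun δ φ => δ / 2 * (Real.cos φ + e) * H (δ / 2 * (1 + σ * Real.cos φ)))
    (r := L) (C := L / 2 * (1 + |e|) * C) hL (by simp) ?_ ?_ ?_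
  · refine h.congr (Eventually.of_forall fun δ => ?_)
    simp only [one_mul, vanishingPeriod]
    rw [intervalIntegral.integral_of_le Real.pi_pos.le]
  · intro δ hδ
    rw [mem_ball_zero_iff] at hδ
    refine (Continuous.mul (by fun_prop) ?_).aestronglyMeasurable
    refine hH.continuousOn.comp_continuous (by fun_prop) fun φ => ?_
    rw [mem_ball_zero_iff]
    linarith [norm_half_mul_one_add_le (δ := δ) hσn (hcos φ)]
  · refine Eventually.of_forall fun φ => ?_
    refine DifferentiableOn.mul (by fun_prop) (hH.comp (by fun_prop) fun δ hδ => ?_)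
    rw [mem_ball_zero_iff] at hδ ⊢
    linarith [norm_half_mul_one_add_le (δ := δ) hσn (hcos φ)]
  · refine Eventually.of_forall fun φ δ hδ => ?_
    rw [mem_ball_zero_iff] at hδ
    rw [norm_mul, norm_mul, norm_div, Complex.norm_ofNat]
    have h1 := norm_half_mul_one_add_le (δ := δ) hσn (hcos φ)
    have h2 : ‖(Real.cos φ : ℂ) + e‖ ≤ 1 + |e| := by
      refine (norm_add_le _ _).trans ?_
      rw [Complex.norm_real e, Real.norm_eq_abs]
      linarith [hcos φ]
    gcongr
    exact hC _ (by linarith)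

theorem analyticAt_ellipseIntegral {H : ℂ → ℂ} {L σ : ℝ} (e : ℝ) (hσ : σ = 1 ∨ σ = -1)
    (hL : 0 < L) (hH : DifferentiableOn ℂ H (Metric.ball 0 (4 * L))) :
    AnalyticAt ℂ (ellipseIntegral H L σ e) 0 := by
  obtain ⟨C, hC0, hC⟩ := exists_bound_of_differentiableOn_ball hL hH
  have hσn : ‖(σ : ℂ)‖ = 1 := by
    rw [Complex.norm_real, Real.norm_eq_abs]
    rcases hσ with rfl | rfl <;> simp
  have hslit : ∀ δ ∈ Metric.ball (0 : ℂ) L, (L : ℂ) ^ 2 - σ * L * δ ∈ Complex.slitPlane := by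
    intro δ hδ
    rw [mem_ball_zero_iff] at hδ
    refine Complex.mem_slitPlane_iff.2 (Or.inl ?_)
    have h1 := (abs_le.1 (Complex.abs_re_le_norm (σ * δ))).2
    rw [norm_mul, hσn, one_mul, Complex.re_ofReal_mul] at h1
    have h2 : ((L : ℂ) ^ 2 - σ * L * δ).re = L ^ 2 - L * (σ * δ.re) := by
      rw [← Complex.ofReal_pow, ← Complex.ofReal_mul, Complex.sub_re, Complex.re_ofReal_mul,
        Complex.ofReal_re]
      ring
    rw [h2]
    nlinarith
  have h := analyticAt_integral_mul_of_bounded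
    (μ := MeasureTheory.volume.restrict (Set.Ioc 0 Real.pi))
    (k := fun φ => ((Real.pi - φ : ℝ) : ℂ))
    (g := fun δ φ => (ellipsePoint L σ δ φ + e * δ / 2) * H (δ / 2 + σ * ellipsePoint L σ δ φ))
    (r := L) (C := (3 * L + |e| * L / 2) * C) hL ?_ ?_ ?_ ?_
  · refine h.congr (Eventually.of_forall fun δ => ?_)
    simp only [ellipseIntegral]
    rw [intervalIntegral.integral_of_le Real.pi_pos.le]
  · exact (Continuous.integrableOn_Ioc (by fun_prop))
  · intro δ hδ
    rw [mem_ball_zero_iff] at hδ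
    have hc : Continuous fun φ => ellipsePoint L σ δ φ := by
      unfold ellipsePoint
      fun_prop
    refine (Continuous.mul (by fun_prop) ?_).aestronglyMeasurable
    refine hH.continuousOn.comp_continuous (by fun_prop) fun φ => ?_
    rw [mem_ball_zero_iff]
    linarith [norm_half_add_ellipsePoint_le hσ hL hδ φ]
  · refine Eventually.of_forall fun φ => ?_
    have hd : DifferentiableOn ℂ (fun δ => ellipsePoint L σ δ φ) (Metric.ball 0 L) := by
      unfold ellipsePoint
      refine DifferentiableOn.add (by fun_prop) (DifferentiableOn.mul_const
        (DifferentiableOn.const_mul (DifferentiableOn.cpow_const (by fun_prop) hslit) _) _)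
    refine DifferentiableOn.mul (hd.add (by fun_prop))
      (hH.comp (DifferentiableOn.add (by fun_prop) (hd.const_mul _)) fun δ hδ => ?_)
    rw [mem_ball_zero_iff] at hδ ⊢
    linarith [norm_half_add_ellipsePoint_le hσ hL hδ φ]
  · refine Eventually.of_forall fun φ δ hδ => ?_
    rw [mem_ball_zero_iff] at hδ
    rw [norm_mul]
    have h2 : ‖ellipsePoint L σ δ φ + e * δ / 2‖ ≤ 3 * L + |e| * L / 2 := by
      refine (norm_add_le _ _).trans ?_
      rw [norm_div, norm_mul, Complex.norm_real e, Real.norm_eq_abs, Complex.norm_ofNat]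
      have := norm_ellipsePoint_le hσ hL hδ φ
      have := mul_le_mul_of_nonneg_left hδ.le (abs_nonneg e)
      linarith
    gcongr
    exact hC _ (norm_half_add_ellipsePoint_le hσ hL hδ φ)

theorem collision_factor {y σ w δ : ℝ} {a : ℤ} (hσ : σ = 1 ∨ σ = -1) (ha : a = 1 ∨ a = -1)
    (hδ : 0 < δ) (hw : 0 ≤ w) (hwy : w ^ 2 = |y ^ 2 - 1|) (h1 : y ≠ 1) (h2 : y ≠ -1) :
    δ / 2 * w * (|δ / 2 * (1 + σ * y)| ^ ((a : ℝ) / 2) *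
      |δ / 2 * (1 + σ * y) - δ| ^ (((-a : ℤ) : ℝ) / 2)) = δ / 2 * |y + σ * a| := by
  have hA : |δ / 2 * (1 + σ * y)| = δ / 2 * |y + σ| := by
    rw [abs_mul, abs_of_pos (by positivity : 0 < δ / 2)]
    rcases hσ with rfl | rfl
    · rw [one_mul, add_comm]
    · rw [show 1 + -1 * y = -(y + -1) by ring, abs_neg]
  have hB : |δ / 2 * (1 + σ * y) - δ| = δ / 2 * |y - σ| := by
    rw [show δ / 2 * (1 + σ * y) - δ = δ / 2 * (σ * y - 1) by ring, abs_mul,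
      abs_of_pos (by positivity : 0 < δ / 2)]
    rcases hσ with rfl | rfl
    · rw [one_mul]
    · rw [show -1 * y - 1 = -(y - -1) by ring, abs_neg]
  have hApos : 0 < δ / 2 * |y + σ| := by
    refine mul_pos (by positivity) (abs_pos.2 fun h => ?_)
    rcases hσ with rfl | rfl
    · exact h2 (by linarith)
    · exact h1 (by linarith)
  have hBpos : 0 < δ / 2 * |y - σ| := by
    refine mul_pos (by positivity) (abs_pos.2 fun h => ?_)
    rcases hσ with rfl | rfl
    · exact h1 (by linarith)
    · exact h2 (by linarith)
  rw [hA, hB]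
  have hpq : δ / 2 * w = √(δ / 2 * |y + σ|) * √(δ / 2 * |y - σ|) := by
    rw [← Real.sqrt_mul hApos.le, eq_comm, Real.sqrt_eq_iff_eq_sq (by positivity) (by positivity),
      mul_pow, hwy]
    have : |y ^ 2 - 1| = |y + σ| * |y - σ| := by
      rw [← abs_mul]
      congr 1
      rcases hσ with rfl | rfl <;> ring
    rw [this]
    ring
  have hp := Real.sqrt_pos.2 hApos
  have hq := Real.sqrt_pos.2 hBpos
  have hneg : ∀ x : ℝ, 0 < x → x ^ ((-1 : ℝ) / 2) = (√x)⁻¹ := fun x hx => by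
    rw [neg_div, Real.rpow_neg hx.le, Real.sqrt_eq_rpow]
  have hp2 := Real.mul_self_sqrt hApos.le
  have hq2 := Real.mul_self_sqrt hBpos.le
  rw [hpq]
  rcases ha with rfl | rfl
  · have e1 : (((-1 : ℤ) : ℤ) : ℝ) / 2 = -1 / 2 := by norm_num
    have e2 : (((1 : ℤ) : ℤ) : ℝ) / 2 = 1 / 2 := by norm_num
    rw [e1, e2, hneg _ hBpos, ← Real.sqrt_eq_rpow]
    rw [Int.cast_one, mul_one]
    refine Eq.trans ?_ hp2
    rw [mul_comm _ (√(δ / 2 * |y - σ|))⁻¹, ← mul_assoc, mul_assoc _ _ (_)⁻¹,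
      mul_inv_cancel₀ hq.ne', mul_one]
  · have e1 : (((-1 : ℤ) : ℤ) : ℝ) / 2 = -1 / 2 := by norm_num
    have e2 : (((- -1 : ℤ) : ℤ) : ℝ) / 2 = 1 / 2 := by norm_num
    rw [e1, e2, hneg _ hApos, ← Real.sqrt_eq_rpow]
    rw [Int.cast_neg, Int.cast_one, mul_neg_one, ← sub_eq_add_neg]
    refine Eq.trans ?_ hq2
    rw [mul_comm (√(δ / 2 * |y + σ|)), ← mul_assoc, mul_assoc _ _ (_)⁻¹,
      mul_inv_cancel₀ hp.ne', mul_one]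

/-- The part within distance `L` of `τ` of an edge that ends at the pair of vertices `τ`, `τ + δ`:
to the right of `τ + δ` if `σ = 1`, to the left of `τ` if `σ = -1`. -/
def collisionSide (τ L σ δ : ℝ) : Set ℝ :=
  {x | δ / 2 < σ * (x - τ - δ / 2) ∧ σ * (x - τ) < L}

theorem collisionSide_eq_image {τ L σ δ : ℝ} (hσ : σ = 1 ∨ σ = -1) (hδ : 0 < δ) (hδL : δ < L) :
    collisionSide τ L σ δ = (fun s => τ + δ / 2 * (1 + σ * Real.cosh s)) ''
      Set.Ioo 0 (Real.arcosh ((2 * L - σ * δ) / δ)) := by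
  have h1 := one_lt_two_mul_sub_div hσ hδ hδL
  have hσ2 : σ * σ = 1 := by rcases hσ with rfl | rfl <;> norm_num
  ext x
  constructor
  · rintro ⟨hx1, hx2⟩
    have hy1 : 1 < σ * (2 * (x - τ) / δ - 1) := by
      rw [show σ * (2 * (x - τ) / δ - 1) = σ * (x - τ - δ / 2) * 2 / δ by field_simp,
        lt_div_iff₀ hδ]
      linarith
    have hy2 : σ * (2 * (x - τ) / δ - 1) < (2 * L - σ * δ) / δ := by
      rw [lt_div_iff₀ hδ, show σ * (2 * (x - τ) / δ - 1) * δ = 2 * (σ * (x - τ)) - σ * δ by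
        field_simp]
      linarith
    refine ⟨Real.arcosh (σ * (2 * (x - τ) / δ - 1)), ⟨Real.arcosh_pos hy1, ?_⟩, ?_⟩
    · rw [Real.arcosh_lt_arcosh (by linarith) (by linarith)]
      exact hy2
    · simp only
      rw [Real.cosh_arcosh hy1.le, ← mul_assoc, hσ2]
      field_simp
      ring
  · rintro ⟨s, ⟨hs1, hs2⟩, rfl⟩
    have hc1 : 1 < Real.cosh s := Real.one_lt_cosh.2 hs1.ne'
    have hc2 : Real.cosh s < (2 * L - σ * δ) / δ := by
      rw [← Real.cosh_arcosh h1.le, Real.cosh_lt_cosh, abs_of_pos hs1, abs_of_pos (hs1.trans hs2)]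
      exact hs2
    rw [lt_div_iff₀ hδ] at hc2
    constructor
    · rw [show σ * (τ + δ / 2 * (1 + σ * Real.cosh s) - τ - δ / 2) =
        σ * σ * (δ / 2 * Real.cosh s) by ring, hσ2]
      nlinarith
    · rw [show σ * (τ + δ / 2 * (1 + σ * Real.cosh s) - τ) =
        δ / 2 * (σ + σ * σ * Real.cosh s) by ring, hσ2]
      linarith

theorem Ioo_eq_image_cos {τ σ δ : ℝ} (hσ : σ = 1 ∨ σ = -1) (hδ : 0 < δ) :
    Set.Ioo τ (τ + δ) = (fun φ => τ + δ / 2 * (1 + σ * Real.cos φ)) '' Set.Ioo 0 Real.pi := by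
  have hσ2 : σ * σ = 1 := by rcases hσ with rfl | rfl <;> norm_num
  ext x
  constructor
  · rintro ⟨hx1, hx2⟩
    have hb : -1 < 2 * (x - τ) / δ - 1 ∧ 2 * (x - τ) / δ - 1 < 1 := by
      have e1 : 0 < 2 * (x - τ) / δ := div_pos (by linarith) hδ
      have e2 : 2 * (x - τ) / δ < 2 := by rw [div_lt_iff₀ hδ]; linarith
      constructor <;> linarith
    have hy : -1 < σ * (2 * (x - τ) / δ - 1) ∧ σ * (2 * (x - τ) / δ - 1) < 1 := by
      rcases hσ with rfl | rfl <;> constructor <;> linarith [hb.1, hb.2]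
    refine ⟨Real.arccos (σ * (2 * (x - τ) / δ - 1)), ⟨Real.arccos_pos.2 hy.2,
      Real.arccos_lt_pi.2 hy.1⟩, ?_⟩
    simp only
    rw [Real.cos_arccos hy.1.le hy.2.le, ← mul_assoc, hσ2]
    field_simp
    ring
  · rintro ⟨φ, ⟨h1, h2⟩, rfl⟩
    have hc1 : Real.cos φ < 1 := by
      have := Real.strictAntiOn_cos ⟨le_rfl, Real.pi_pos.le⟩ ⟨h1.le, h2.le⟩ h1
      rwa [Real.cos_zero] at this
    have hc2 : -1 < Real.cos φ := by
      have := Real.strictAntiOn_cos ⟨h1.le, h2.le⟩ ⟨Real.pi_pos.le, le_rfl⟩ h2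
      rwa [Real.cos_pi] at this
    simp only [Set.mem_Ioo]
    rcases hσ with rfl | rfl <;> constructor <;> nlinarith

theorem integral_collisionSide {τ L σ δ : ℝ} {a : ℤ} (g : ℝ → ℝ) (hσ : σ = 1 ∨ σ = -1)
    (ha : a = 1 ∨ a = -1) (hδ : 0 < δ) (hδL : δ < L) :
    ∫ x in collisionSide τ L σ δ, |x - τ| ^ ((a : ℝ) / 2) *
        |x - τ - δ| ^ (((-a : ℤ) : ℝ) / 2) * g (x - τ) =
      ∫ s in (0 : ℝ)..Real.arcosh ((2 * L - σ * δ) / δ),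
        δ / 2 * (Real.cosh s + σ * a) * g (δ / 2 * (1 + σ * Real.cosh s)) := by
  have h1 := one_lt_two_mul_sub_div hσ hδ hδL
  have hσ2 : |σ| = 1 := by rcases hσ with rfl | rfl <;> norm_num
  have hσ0 : σ ≠ 0 := by rcases hσ with rfl | rfl <;> norm_num
  rw [collisionSide_eq_image hσ hδ hδL, MeasureTheory.integral_image_eq_integral_abs_deriv_smul
    measurableSet_Ioo (f' := fun s => δ / 2 * (σ * Real.sinh s)),
    intervalIntegral.integral_of_le (Real.arcosh_nonneg h1.le),
    MeasureTheory.integral_Ioc_eq_integral_Ioo]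
  · refine MeasureTheory.setIntegral_congr_fun measurableSet_Ioo fun s hs => ?_
    have hsinh : 0 < Real.sinh s := Real.sinh_pos_iff.2 hs.1
    have hc1 : 1 < Real.cosh s := Real.one_lt_cosh.2 hs.1.ne'
    have key := collision_factor (y := Real.cosh s) (w := Real.sinh s) (a := a) hσ ha hδ hsinh.le
      (by rw [Real.sinh_sq, abs_of_pos (by nlinarith)]) hc1.ne' (by linarith)
    have habs : |Real.cosh s + σ * a| = Real.cosh s + σ * a := by
      refine abs_of_pos ?_
      rcases hσ with rfl | rfl <;> rcases ha with rfl | rfl <;> push_cast <;> linarith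
    rw [habs] at key
    simp only [add_sub_cancel_left, smul_eq_mul]
    rw [abs_mul, abs_mul, hσ2, one_mul, abs_of_pos hsinh, abs_of_pos (by positivity : 0 < δ / 2),
      ← mul_assoc, key]
  · intro s _
    refine HasDerivAt.hasDerivWithinAt ?_
    exact ((((Real.hasDerivAt_cosh s).const_mul σ).const_add 1).const_mul (δ / 2)).const_add τ
  · intro s hs s' hs' h
    refine Real.cosh_injOn hs.1.le hs'.1.le ?_
    have h2 : δ / 2 * σ * (Real.cosh s - Real.cosh s') = 0 := by
      simp only at h
      linarith
    rcases mul_eq_zero.1 h2 with h3 | h3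
    · exact absurd h3 (by positivity)
    · linarith

theorem integral_collision_segment {τ σ δ : ℝ} {a : ℤ} (g : ℝ → ℝ) (hσ : σ = 1 ∨ σ = -1)
    (ha : a = 1 ∨ a = -1) (hδ : 0 < δ) :
    ∫ x in Set.Ioo τ (τ + δ), |x - τ| ^ ((a : ℝ) / 2) *
        |x - τ - δ| ^ (((-a : ℤ) : ℝ) / 2) * g (x - τ) =
      σ * a * ∫ φ in (0 : ℝ)..Real.pi,
        δ / 2 * (Real.cos φ + σ * a) * g (δ / 2 * (1 + σ * Real.cos φ)) := by
  have hσ2 : |σ| = 1 := by rcases hσ with rfl | rfl <;> norm_num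
  have hσ0 : σ ≠ 0 := by rcases hσ with rfl | rfl <;> norm_num
  rw [Ioo_eq_image_cos hσ hδ, MeasureTheory.integral_image_eq_integral_abs_deriv_smul
    measurableSet_Ioo (f' := fun s => δ / 2 * (σ * -Real.sin s)),
    ← intervalIntegral.integral_const_mul, intervalIntegral.integral_of_le Real.pi_pos.le,
    MeasureTheory.integral_Ioc_eq_integral_Ioo]
  · refine MeasureTheory.setIntegral_congr_fun measurableSet_Ioo fun s hs => ?_
    have hsin : 0 < Real.sin s := Real.sin_pos_of_mem_Ioo hs
    have hsq := Real.sin_sq_add_cos_sq s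
    have hc : Real.cos s ^ 2 < 1 := by nlinarith
    have hc1 : Real.cos s < 1 := by nlinarith
    have hc2 : -1 < Real.cos s := by nlinarith
    have key := collision_factor (y := Real.cos s) (w := Real.sin s) (a := a) hσ ha hδ hsin.le
      (by rw [abs_of_neg (by linarith)]; linarith) hc1.ne hc2.ne'
    have habs : |Real.cos s + σ * a| = σ * a * (Real.cos s + σ * a) := by
      rcases hσ with rfl | rfl <;> rcases ha with rfl | rfl <;> push_cast <;>
      first
        | (rw [abs_of_pos (by linarith)]; ring)
        | (rw [abs_of_neg (by linarith)]; ring)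
    rw [habs] at key
    simp only [add_sub_cancel_left, smul_eq_mul]
    rw [abs_mul, abs_mul, hσ2, one_mul, abs_neg, abs_of_pos hsin,
      abs_of_pos (by positivity : 0 < δ / 2), ← mul_assoc, key]
    ring
  · intro s _
    refine HasDerivAt.hasDerivWithinAt ?_
    exact ((((Real.hasDerivAt_cos s).const_mul σ).const_add 1).const_mul (δ / 2)).const_add τ
  · intro s hs s' hs' h
    refine Real.injOn_cos ⟨hs.1.le, hs.2.le⟩ ⟨hs'.1.le, hs'.2.le⟩ ?_
    have h2 : δ / 2 * σ * (Real.cos s - Real.cos s') = 0 := by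
      simp only at h
      linarith
    rcases mul_eq_zero.1 h2 with h3 | h3
    · exact absurd h3 (by positivity)
    · linarith

/-- `arcosh ((2L - σδ)/δ) + log δ` is analytic at `δ = 0`. -/
theorem exists_analyticAt_arcosh_add_log {L σ : ℝ} (hσ : σ = 1 ∨ σ = -1) (hL : 0 < L) :
    ∃ g : ℝ → ℝ, AnalyticAt ℝ g 0 ∧ ∀ δ, 0 < δ → δ < L →
      Real.arcosh ((2 * L - σ * δ) / δ) = g δ - Real.log δ := by
  refine ⟨fun δ => Real.log (2 * L - σ * δ + 2 * √(L ^ 2 - σ * L * δ)), ?_, ?_⟩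
  · have h1 : AnalyticAt ℝ (fun δ : ℝ => √(L ^ 2 - σ * L * δ)) 0 := by
      have hs : AnalyticAt ℝ Real.sqrt (L ^ 2 - σ * L * 0) :=
        (Real.contDiffAt_sqrt (n := ⊤) (by simpa using hL.ne')).analyticAt
      exact hs.comp (f := fun δ : ℝ => L ^ 2 - σ * L * δ) (by fun_prop)
    refine AnalyticAt.log ?_ ?_
    · exact (AnalyticAt.sub (by fun_prop) (by fun_prop)).add (analyticAt_const.mul h1)
    · simp only [mul_zero, sub_zero]
      positivity
  · intro δ hδ hδL
    have hσ2 : σ ^ 2 = 1 := by rcases hσ with rfl | rfl <;> norm_num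
    have hsq : √(((2 * L - σ * δ) / δ) ^ 2 - 1) = 2 / δ * √(L ^ 2 - σ * L * δ) := by
      rw [show ((2 * L - σ * δ) / δ) ^ 2 - 1 = (2 / δ) ^ 2 * (L ^ 2 - σ * L * δ) by
        field_simp
        linear_combination δ ^ 2 * hσ2, Real.sqrt_mul (by positivity),
        Real.sqrt_sq (by positivity)]
    have hpos : 0 < 2 * L - σ * δ := by rcases hσ with rfl | rfl <;> linarith
    rw [Real.arcosh, hsq, ← Real.log_div (by positivity) hδ.ne']
    congr 1
    field_simp

/-- The logarithmic singularity of the length of an edge next to two colliding vertices. -/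
theorem exists_analyticAt_integral_collisionSide {τ L σ : ℝ} {a : ℤ} {H : ℂ → ℂ} {h : ℝ → ℝ}
    (hσ : σ = 1 ∨ σ = -1) (ha : a = 1 ∨ a = -1) (hL : 0 < L)
    (hH : DifferentiableOn ℂ H (Metric.ball 0 (4 * L)))
    (hreal : ∀ x : ℝ, |x| < 4 * L → H x = h x) :
    ∃ b g : ℝ → ℝ, AnalyticAt ℝ b 0 ∧ AnalyticAt ℝ g 0 ∧ ∀ δ, 0 < δ → δ < L →
      (∫ x in Set.Ioo τ (τ + δ), |x - τ| ^ ((a : ℝ) / 2) *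
        |x - τ - δ| ^ (((-a : ℤ) : ℝ) / 2) * h (x - τ) = b δ) ∧
      (∫ x in collisionSide τ L σ δ, |x - τ| ^ ((a : ℝ) / 2) *
        |x - τ - δ| ^ (((-a : ℤ) : ℝ) / 2) * h (x - τ)) =
          g δ - σ * a * (Real.log δ / Real.pi * b δ) := by
  obtain ⟨l, hl, hlog⟩ := exists_analyticAt_arcosh_add_log hσ hL
  have hσa : (σ * a) * (σ * a) = 1 := by
    rcases hσ with rfl | rfl <;> rcases ha with rfl | rfl <;> norm_num
  have hB := (analyticAt_vanishingPeriod (σ * a) hσ hL hH)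
  have hE := (analyticAt_ellipseIntegral (σ * a) hσ hL hH)
  have hB' : AnalyticAt ℝ (fun δ : ℝ => (vanishingPeriod H σ (σ * a) δ).re) 0 :=
    AnalyticAt.re_ofReal (by simpa using hB)
  have hE' : AnalyticAt ℝ (fun δ : ℝ => (ellipseIntegral H L σ (σ * a) δ).im) 0 :=
    AnalyticAt.im_ofReal (by simpa using hE)
  refine ⟨fun δ => σ * a * (vanishingPeriod H σ (σ * a) δ).re,
    fun δ => (l δ * (vanishingPeriod H σ (σ * a) δ).re +
      (ellipseIntegral H L σ (σ * a) δ).im) / Real.pi,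
    analyticAt_const.mul hB', ((hl.mul hB').add hE').div_const, fun δ hδ hδL => ⟨?_, ?_⟩⟩
  · rw [integral_collision_segment h hσ ha hδ]
    congr 1
    rw [← Complex.ofReal_re (∫ φ in (0 : ℝ)..Real.pi,
        δ / 2 * (Real.cos φ + σ * a) * h (δ / 2 * (1 + σ * Real.cos φ))),
      ← intervalIntegral.integral_ofReal, vanishingPeriod]
    congr 1
    refine intervalIntegral.integral_congr fun φ _ => ?_
    have hb : |δ / 2 * (1 + σ * Real.cos φ)| < 4 * L := by
      have hc1 := Real.cos_le_one φ
      have hc2 := Real.neg_one_le_cos φ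
      rw [abs_lt]
      rcases hσ with rfl | rfl <;> constructor <;> nlinarith
    have := hreal _ hb
    push_cast at this ⊢
    rw [this]
  · rw [integral_collisionSide h hσ ha hδ hδL]
    have key := integral_cosh_eq (σ * a) hσ hδ hδL hH (fun x hx => by rw [hreal x hx]; simp)
    have hcongr : ∫ s in (0 : ℝ)..Real.arcosh ((2 * L - σ * δ) / δ), δ / 2 *
        (Real.cosh s + σ * a) * (H ((δ / 2 * (1 + σ * Real.cosh s) : ℝ) : ℂ)).re =
        ∫ s in (0 : ℝ)..Real.arcosh ((2 * L - σ * δ) / δ),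
        δ / 2 * (Real.cosh s + σ * a) * h (δ / 2 * (1 + σ * Real.cosh s)) := by
      have h1 := one_lt_two_mul_sub_div hσ hδ hδL
      refine intervalIntegral.integral_congr fun s hs => ?_
      rw [Set.uIcc_of_le (Real.arcosh_nonneg h1.le)] at hs
      have hc1 := Real.one_le_cosh s
      have hc2 : Real.cosh s ≤ (2 * L - σ * δ) / δ := by
        rw [← Real.cosh_arcosh h1.le, Real.cosh_le_cosh, abs_of_nonneg hs.1,
          abs_of_nonneg (hs.1.trans hs.2)]
        exact hs.2
      rw [le_div_iff₀ hδ] at hc2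
      have hb : |δ / 2 * (1 + σ * Real.cosh s)| < 4 * L := by
        rw [abs_lt]
        rcases hσ with rfl | rfl <;> constructor <;> nlinarith
      rw [hreal _ hb, Complex.ofReal_re]
    rw [hcongr, hlog δ hδ hδL] at key
    rw [hlog δ hδ hδL]
    generalize (∫ s in (0 : ℝ)..(l δ - Real.log δ),
      δ / 2 * (Real.cosh s + σ * a) * h (δ / 2 * (1 + σ * Real.cosh s))) = J at key ⊢
    have hpi := Real.pi_ne_zero
    field_simp
    linear_combination key + Real.log δ * (vanishingPeriod H σ (σ * a) δ).re * hσa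

theorem abs_rpow_eq_mul_one_add_div {u v r : ℝ} (hv : v ≠ 0) (h : |u| < |v|) :
    |u + v| ^ r = |v| ^ r * (1 + u / v) ^ r ∧ 0 < 1 + u / v := by
  have h1 : |u / v| < 1 := by
    rw [abs_div, div_lt_one (abs_pos.2 hv)]
    exact h
  have h2 : 0 < 1 + u / v := by linarith [(abs_lt.1 h1).1]
  refine ⟨?_, h2⟩
  rw [← Real.mul_rpow (abs_nonneg _) h2.le]
  congr 1
  rw [← abs_of_pos h2, ← abs_mul]
  congr 1
  field_simp
  ring

namespace SCData

variable {n : ℕ}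

theorem AlternatesOn.mono {S : SCData n} {p q p' q' : ℕ} (h : S.AlternatesOn p q) (hp : p ≤ p')
    (hq : q' ≤ q) : S.AlternatesOn p' q' :=
  ⟨fun k hk => h.1 k (Finset.Icc_subset_Icc hp hq hk),
    fun k hk => h.2 k (Finset.Ico_subset_Ico hp hq hk)⟩

/-- The absolute value of the factors of the integrand that belong to the vertices other than
number `j` and `j + 1`, as a function of the distance from vertex number `j`. -/
noncomputable def restNorm (S : SCData n) (j : ℕ) (x : ℝ) : ℝ :=
  ∏ k ∈ ((Finset.Icc 1 n).erase j).erase (j + 1), |x + (S.t j - S.t k)| ^ ((S.a k : ℝ) / 2)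

/-- The holomorphic continuation of `restNorm`. -/
noncomputable def restContinuation (S : SCData n) (j : ℕ) (z : ℂ) : ℂ :=
  ∏ k ∈ ((Finset.Icc 1 n).erase j).erase (j + 1),
    ((|S.t j - S.t k| ^ ((S.a k : ℝ) / 2) : ℝ) : ℂ) *
      (1 + z / ((S.t j - S.t k : ℝ) : ℂ)) ^ ((((S.a k : ℝ) / 2 : ℝ)) : ℂ)

/-- All vertices other than number `j` and `j + 1` have distance at least `4 * L` from vertex
number `j`. -/
def Isolated (S : SCData n) (j : ℕ) (L : ℝ) : Prop :=
  ∀ k ∈ ((Finset.Icc 1 n).erase j).erase (j + 1), 4 * L ≤ |S.t j - S.t k|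

theorem Isolated.differentiableOn {S : SCData n} {j : ℕ} {L : ℝ} (h : S.Isolated j L)
    (hL : 0 < L) : DifferentiableOn ℂ (S.restContinuation j) (Metric.ball 0 (4 * L)) := by
  unfold restContinuation
  refine DifferentiableOn.fun_finsetProd fun k hk => DifferentiableOn.const_mul ?_ _
  refine DifferentiableOn.cpow_const (by fun_prop) fun z hz => ?_
  rw [mem_ball_zero_iff] at hz
  have hpos : 0 < |S.t j - S.t k| := lt_of_lt_of_le (by linarith) (h k hk)
  refine Complex.mem_slitPlane_iff.2 (Or.inl ?_)
  have h1 : ‖z / ((S.t j - S.t k : ℝ) : ℂ)‖ < 1 := by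
    rw [norm_div, Complex.norm_real, Real.norm_eq_abs, div_lt_one hpos]
    exact hz.trans_le (h k hk)
  have h2 := (abs_le.1 (Complex.abs_re_le_norm (z / ((S.t j - S.t k : ℝ) : ℂ)))).1
  rw [Complex.add_re, Complex.one_re]
  linarith

theorem Isolated.restContinuation_ofReal {S : SCData n} {j : ℕ} {L : ℝ} (h : S.Isolated j L)
    (hL : 0 < L) {x : ℝ} (hx : |x| < 4 * L) : S.restContinuation j x = S.restNorm j x := by
  rw [restContinuation, restNorm, Complex.ofReal_prod]
  refine Finset.prod_congr rfl fun k hk => ?_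
  have hpos : 0 < |S.t j - S.t k| := lt_of_lt_of_le (by linarith) (h k hk)
  obtain ⟨h1, h2⟩ := abs_rpow_eq_mul_one_add_div (r := (S.a k : ℝ) / 2) (abs_pos.1 hpos)
    (hx.trans_le (h k hk))
  rw [h1, Complex.ofReal_mul, Complex.ofReal_cpow h2.le]
  push_cast
  rfl

theorem exists_isolated (S : SCData n) {j : ℕ} (hj : 1 ≤ j) (hjn : j + 1 ≤ n)
    (hS : StrictMonoOn S.t (Set.Icc 1 n)) : ∃ L, 0 < L ∧ S.Isolated j L := by
  have key : ∀ s : Finset ℕ, (∀ k ∈ s, 0 < |S.t j - S.t k|) →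
      ∃ L, 0 < L ∧ ∀ k ∈ s, 4 * L ≤ |S.t j - S.t k| := by
    intro s hs
    induction s using Finset.induction_on with
    | empty => exact ⟨1, one_pos, by simp⟩
    | insert k s _ ih =>
      obtain ⟨L, hL, h⟩ := ih fun l hl => hs l (Finset.mem_insert_of_mem hl)
      have hk := hs k (Finset.mem_insert_self k s)
      refine ⟨min L (|S.t j - S.t k| / 4), lt_min hL (by positivity), fun l hl => ?_⟩
      rcases Finset.mem_insert.1 hl with rfl | hl
      · linarith [min_le_right L (|S.t j - S.t l| / 4)]
      · linarith [min_le_left L (|S.t j - S.t k| / 4), h l hl]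
  refine key _ fun k hk => ?_
  rw [Finset.mem_erase, Finset.mem_erase, Finset.mem_Icc] at hk
  exact abs_pos.2 (sub_ne_zero.2 fun h => hk.2.1
    (hS.injOn ⟨hk.2.2.1, hk.2.2.2⟩ ⟨by omega, by omega⟩ h.symm))

theorem moveVertex_t_of_ne (S : SCData n) {j k : ℕ} (δ : ℝ) (h : k ≠ j + 1) :
    (S.moveVertex j δ).t k = S.t k := Function.update_of_ne h _ _

theorem moveVertex_t_succ (S : SCData n) (j : ℕ) (δ : ℝ) :
    (S.moveVertex j δ).t (j + 1) = S.t j + δ := Function.update_self _ _ _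

theorem norm_integrand_moveVertex (S : SCData n) {j : ℕ} (hj : 1 ≤ j) (hjn : j + 1 ≤ n)
    (δ x : ℝ) :
    ‖(S.moveVertex j δ).integrand x‖ = |x - S.t j| ^ ((S.a j : ℝ) / 2) *
      |x - S.t j - δ| ^ ((S.a (j + 1) : ℝ) / 2) * S.restNorm j (x - S.t j) := by
  rw [norm_integrand_ofReal, ← Finset.mul_prod_erase _ _ (Finset.mem_Icc.2 ⟨hj, by omega⟩),
    ← Finset.mul_prod_erase _ _ (Finset.mem_erase.2 ⟨(Nat.succ_ne_self j),
      Finset.mem_Icc.2 ⟨by omega, hjn⟩⟩), ← mul_assoc, restNorm]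
  congr 1
  · rw [moveVertex_t_of_ne _ _ (Nat.succ_ne_self j).symm, Nat.succ_eq_add_one, moveVertex_t_succ,
      ← sub_sub]
    rfl
  · refine Finset.prod_congr rfl fun k hk => ?_
    rw [moveVertex_t_of_ne _ _ (Finset.mem_erase.1 hk).1]
    congr 2
    ring

theorem Isolated.gap {S : SCData n} {j : ℕ} {L : ℝ} (h : S.Isolated j L)
    (hj : 1 ≤ j) (hjn : j + 1 ≤ n)
    (hS : StrictMonoOn S.t (Set.Icc 1 n)) {k : ℕ} (hk : k ∈ Set.Icc 1 n) :
    (k < j → S.t k ≤ S.t j - 4 * L) ∧ (j + 1 < k → S.t j + 4 * L ≤ S.t k) := by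
  refine ⟨fun hkj => ?_, fun hkj => ?_⟩
  · have h1 := h k (by simp only [Finset.mem_erase, Finset.mem_Icc]; exact
      ⟨by omega, by omega, hk.1, hk.2⟩)
    have h2 := hS hk ⟨by omega, by omega⟩ hkj
    rw [abs_of_pos (by linarith)] at h1
    linarith
  · have h1 := h k (by simp only [Finset.mem_erase, Finset.mem_Icc]; exact
      ⟨by omega, by omega, hk.1, hk.2⟩)
    have h2 := hS (a := j) ⟨by omega, by omega⟩ hk (by omega)
    rw [abs_of_neg (by linarith)] at h1
    linarith

theorem Isolated.strictMonoOn_moveVertex {S : SCData n} {j : ℕ} {L : ℝ} (h : S.Isolated j L)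
    (hj : 1 ≤ j) (hjn : j + 1 ≤ n) (hS : StrictMonoOn S.t (Set.Icc 1 n)) {δ : ℝ} (hδ : 0 < δ)
    (hδL : δ < L) : StrictMonoOn (S.moveVertex j δ).t (Set.Icc 1 n) := by
  intro k hk l hl hkl
  by_cases hk1 : k = j + 1
  · subst hk1
    rw [moveVertex_t_succ, moveVertex_t_of_ne _ _ (by omega)]
    linarith [(h.gap hj hjn hS hl).2 hkl]
  · by_cases hl1 : l = j + 1
    · subst hl1
      rw [moveVertex_t_succ, moveVertex_t_of_ne _ _ (by omega)]
      have := hS.monotoneOn hk ⟨hj, by omega⟩ (by omega : k ≤ j)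
      linarith
    · rw [moveVertex_t_of_ne _ _ hk1, moveVertex_t_of_ne _ _ hl1]
      exact hS hk hl hkl

/-- `-1` or `1` according as edge `i` lies to the left or to the right of edge `j`. -/
noncomputable def side (i j : ℕ) : ℝ := if i < j then -1 else 1

theorem side_eq (i j : ℕ) : side i j = 1 ∨ side i j = -1 := by
  unfold side
  split_ifs <;> simp

theorem Isolated.oddEdges_inter_near {S : SCData n} {i j : ℕ} {L : ℝ} (h : S.Isolated j L)
    (hi : i ≤ n) (hj : 1 ≤ j) (hjn : j + 1 ≤ n) (hij : i + 2 ≤ j ∨ j + 2 ≤ i)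
    (hpar : Even (i + j)) (hS : StrictMonoOn S.t (Set.Icc 1 n)) {δ : ℝ} (hδ : 0 < δ)
    (hδL : δ < L) :
    (S.moveVertex j δ).oddEdges (min i j) (max i j) ∩ {x | |x - S.t j| < L} =
      collisionSide (S.t j) L (side i j) δ := by
  rw [Nat.even_iff] at hpar
  ext x
  rcases hij with hij | hij
  · rw [side, if_pos (by omega), min_eq_left (by omega), max_eq_right (by omega)]
    constructor
    · rintro ⟨⟨k, h1, h2, h3, h4, h5⟩, hx⟩
      rw [Set.mem_ofPred_eq, abs_lt] at hx
      rw [moveVertex_t_of_ne _ _ (by omega)] at h5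
      have hkj : k + 1 = j := by
        by_contra hne
        have := (h.gap hj hjn hS (k := k + 1) ⟨by omega, by omega⟩).1 (by omega)
        linarith
      rw [hkj] at h5
      constructor <;> linarith
    · rintro ⟨h1, h2⟩
      refine ⟨⟨j - 1, by omega, by omega, by rw [Nat.odd_iff]; omega, ?_, ?_⟩, ?_⟩
      · rw [moveVertex_t_of_ne _ _ (by omega)]
        have := (h.gap hj hjn hS (k := j - 1) ⟨by omega, by omega⟩).1 (by omega)
        linarith
      · rw [moveVertex_t_of_ne _ _ (by omega), Nat.sub_add_cancel hj]
        linarith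
      · rw [Set.mem_ofPred_eq, abs_lt]
        constructor <;> linarith
  · rw [side, if_neg (by omega), min_eq_right (by omega), max_eq_left (by omega)]
    constructor
    · rintro ⟨⟨k, h1, h2, h3, h4, h5⟩, hx⟩
      rw [Set.mem_ofPred_eq, abs_lt] at hx
      have hkj : k = j + 1 := by
        by_contra hne
        have := (h.gap hj hjn hS (k := k) ⟨by omega, by omega⟩).2 (by omega)
        rw [moveVertex_t_of_ne _ _ hne] at h4
        linarith
      rw [hkj, moveVertex_t_succ] at h4
      constructor <;> linarith
    · rintro ⟨h1, h2⟩
      refine ⟨⟨j + 1, by omega, by omega, by rw [Nat.odd_iff]; omega, ?_, ?_⟩, ?_⟩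
      · rw [moveVertex_t_succ]
        linarith
      · rw [moveVertex_t_of_ne _ _ (by omega)]
        have := (h.gap hj hjn hS (k := j + 1 + 1) ⟨by omega, by omega⟩).2 (by omega)
        linarith
      · rw [Set.mem_ofPred_eq, abs_lt]
        constructor <;> linarith

theorem oddEdges_moveVertex_inter_far (S : SCData n) (i j : ℕ) {L δ : ℝ}
    (hδ : 0 ≤ δ) (hδL : δ < L) :
    (S.moveVertex j δ).oddEdges (min i j) (max i j) ∩ {x | |x - S.t j| < L}ᶜ =
      (S.moveVertex j 0).oddEdges (min i j) (max i j) ∩ {x | |x - S.t j| < L}ᶜ := by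
  ext x
  simp only [Set.mem_inter_iff, and_congr_left_iff]
  intro hx
  rw [Set.mem_compl_iff, Set.mem_ofPred_eq, not_lt] at hx
  refine exists_congr fun k => ?_
  refine and_congr_right fun h1 => and_congr_right fun h2 => and_congr_right fun _ => ?_
  have hk : k ≠ j := by
    rintro rfl
    rcases le_total i k with h | h
    · rw [max_eq_right h] at h2
      exact lt_irrefl _ h2
    · rw [min_eq_right h] at h1
      exact lt_irrefl _ h1
  rw [moveVertex_t_of_ne S (k := k + 1) δ (by omega),
    moveVertex_t_of_ne S (k := k + 1) 0 (by omega)]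
  refine and_congr_left fun _ => ?_
  by_cases hkj : k = j + 1
  · rw [hkj, moveVertex_t_succ, moveVertex_t_succ]
    constructor
    · intro h
      linarith
    · intro h
      rw [abs_of_pos (by linarith)] at hx
      linarith
  · rw [moveVertex_t_of_ne _ _ hkj, moveVertex_t_of_ne _ _ hkj]

/-- The lengths of the edges far from the colliding vertices depend analytically on `δ`. -/
theorem exists_analyticAt_far (S : SCData n) {i j : ℕ} {L : ℝ} (hL : 0 < L)
    (hi : i ≤ n) (hj : 1 ≤ j) (hjn : j + 1 ≤ n) (hS : StrictMonoOn S.t (Set.Icc 1 n))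
    (halt : S.AlternatesOn (min (i + 1) j) (max i (j + 1))) :
    ∃ g : ℝ → ℝ, AnalyticAt ℝ g 0 ∧ ∀ δ, 0 < δ → δ < L / 2 →
      ∫ x in (S.moveVertex j δ).oddEdges (min i j) (max i j) ∩ {x | |x - S.t j| < L}ᶜ,
        ‖(S.moveVertex j δ).integrand x‖ = g δ := by
  set E := (S.moveVertex j 0).oddEdges (min i j) (max i j) ∩ {x | |x - S.t j| < L}ᶜ with hE
  have hopen : IsOpen {x | |x - S.t j| < L} := isOpen_lt (by fun_prop) continuous_const
  have hEm : MeasurableSet E :=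
    ((S.moveVertex j 0).isOpen_oddEdges _ _).measurableSet.inter hopen.measurableSet.compl
  have hfar : ∀ x ∈ E, L ≤ |x - S.t j| := fun x hx => not_lt.1 hx.2
  have ha : S.a (j + 1) = 1 ∨ S.a (j + 1) = -1 :=
    halt.1 (j + 1) (Finset.mem_Icc.2 ⟨by omega, by omega⟩)
  have hmono0 : ∀ {k l : ℕ}, 1 ≤ k → k ≤ l → l ≤ n →
      (S.moveVertex j 0).t k ≤ (S.moveVertex j 0).t l := by
    intro k l hk hkl hl
    by_cases hk1 : k = j + 1
    · by_cases hl1 : l = j + 1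
      · rw [hk1, hl1]
      · rw [hk1, moveVertex_t_succ, moveVertex_t_of_ne _ _ hl1, add_zero]
        exact hS.monotoneOn ⟨hj, by omega⟩ ⟨by omega, hl⟩ (by omega)
    · by_cases hl1 : l = j + 1
      · rw [hl1, moveVertex_t_succ, moveVertex_t_of_ne _ _ hk1, add_zero]
        exact hS.monotoneOn ⟨hk, by omega⟩ ⟨hj, by omega⟩ (by omega)
      · rw [moveVertex_t_of_ne _ _ hk1, moveVertex_t_of_ne _ _ hl1]
        exact hS.monotoneOn ⟨hk, by omega⟩ ⟨by omega, hl⟩ hkl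
  have hint : MeasureTheory.IntegrableOn (fun x : ℝ => ‖(S.moveVertex j 0).integrand x‖) E := by
    set K : Set ℝ := Set.Icc ((S.moveVertex j 0).t (min i j + 1)) ((S.moveVertex j 0).t (max i j)) ∩
      {x | |x - S.t j| < L}ᶜ with hK
    have hKc : IsCompact K := isCompact_Icc.inter_right hopen.isClosed_compl
    have hEK : E ⊆ K := by
      rintro x ⟨⟨k, h1, h2, h3, h4, h5⟩, hx⟩
      refine ⟨⟨?_, ?_⟩, hx⟩
      · exact (hmono0 (by omega) (by omega) (by omega)).trans h4.le
      · exact h5.le.trans (hmono0 (by omega) (by omega) (by omega))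
    refine MeasureTheory.IntegrableOn.mono_set ?_ hEK
    refine (S.moveVertex j 0).integrableOn_norm_integrand hKc ?_
    rintro k hk ⟨hk1, hk2⟩
    rw [Set.mem_compl_iff, Set.mem_ofPred_eq, not_lt] at hk2
    rw [Finset.mem_Icc] at hk
    have hkj1 : k ≠ j + 1 := by
      rintro rfl
      rw [moveVertex_t_succ] at hk2
      simp only [add_zero, sub_self, abs_zero] at hk2
      linarith
    have hkj : k ≠ j := by
      rintro rfl
      rw [moveVertex_t_of_ne _ _ (by omega)] at hk2
      simp only [sub_self, abs_zero] at hk2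
      linarith
    have huniq : ∀ l ∈ Finset.Icc 1 n, (S.moveVertex j 0).t l = (S.moveVertex j 0).t k →
        l = k := by
      intro l hl hlk
      rw [Finset.mem_Icc] at hl
      by_cases hl1 : l = j + 1
      · rw [hl1, moveVertex_t_succ, moveVertex_t_of_ne _ _ hkj1, add_zero] at hlk
        exact absurd (hS.injOn ⟨hj, by omega⟩ ⟨hk.1, hk.2⟩ hlk).symm hkj
      · rw [moveVertex_t_of_ne _ _ hl1, moveVertex_t_of_ne _ _ hkj1] at hlk
        exact hS.injOn ⟨hl.1, hl.2⟩ ⟨hk.1, hk.2⟩ hlk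
    refine ⟨?_, huniq⟩
    have hkl : min i j + 1 ≤ k := by
      by_contra hc
      have h1 := le_antisymm (hmono0 hk.1 (by omega) (by omega)) hk1.1
      have h2 := huniq (min i j + 1) (Finset.mem_Icc.2 ⟨by omega, by omega⟩) h1.symm
      omega
    have hku : k ≤ max i j := by
      by_contra hc
      have h1 := le_antisymm (hmono0 (k := max i j) (by omega) (by omega) hk.2) hk1.2
      have h2 := huniq (max i j) (Finset.mem_Icc.2 ⟨by omega, by omega⟩) h1
      omega
    change -2 < S.a k
    rcases halt.1 k (Finset.mem_Icc.2 ⟨by omega, by omega⟩) with h3 | h3 <;> rw [h3] <;> norm_num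
  have hsmall : ∀ δ ∈ Metric.ball (0 : ℂ) (L / 2), ∀ x ∈ E,
      ‖δ / ((x - S.t j : ℝ) : ℂ)‖ ≤ 1 / 2 := by
    intro δ hδ x hx
    rw [mem_ball_zero_iff] at hδ
    have := hfar x hx
    rw [norm_div, Complex.norm_real, Real.norm_eq_abs, div_le_iff₀ (by linarith)]
    linarith
  have hana := analyticAt_integral_mul_of_bounded
    (μ := MeasureTheory.volume.restrict E)
    (k := fun x => ((‖(S.moveVertex j 0).integrand x‖ : ℝ) : ℂ))
    (g := fun δ x => (1 - δ / ((x - S.t j : ℝ) : ℂ)) ^ ((((S.a (j + 1) : ℝ) / 2 : ℝ)) : ℂ))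
    (r := L / 2) (C := 2) (by linarith) hint.ofReal ?_ ?_ ?_
  · rw [← Complex.ofReal_zero] at hana
    refine ⟨_, hana.re_ofReal, fun δ hδ hδL => ?_⟩
    rw [S.oddEdges_moveVertex_inter_far i j hδ.le (by linarith), ← hE]
    rw [← Complex.ofReal_re (∫ x in E, ‖(S.moveVertex j δ).integrand x‖), ← integral_complex_ofReal]
    congr 1
    refine MeasureTheory.setIntegral_congr_fun hEm fun x hx => ?_
    have hxfar := hfar x hx
    have hx0 : x - S.t j ≠ 0 := abs_pos.1 (by linarith)
    obtain ⟨h1, h2⟩ := abs_rpow_eq_mul_one_add_div (u := -δ) (v := x - S.t j)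
      (r := (S.a (j + 1) : ℝ) / 2) hx0 (by rw [abs_neg, abs_of_pos hδ]; linarith)
    have h3 : ‖(S.moveVertex j δ).integrand x‖ = ‖(S.moveVertex j 0).integrand x‖ *
        (1 + -δ / (x - S.t j)) ^ ((S.a (j + 1) : ℝ) / 2) := by
      rw [S.norm_integrand_moveVertex hj hjn, S.norm_integrand_moveVertex hj hjn, sub_zero,
        show x - S.t j - δ = -δ + (x - S.t j) by ring, h1]
      ring
    have h4 : (1 - (δ : ℂ) / ((x - S.t j : ℝ) : ℂ)) ^ ((((S.a (j + 1) : ℝ) / 2 : ℝ)) : ℂ) =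
        (((1 + -δ / (x - S.t j)) ^ ((S.a (j + 1) : ℝ) / 2) : ℝ) : ℂ) := by
      rw [Complex.ofReal_cpow h2.le]
      congr 1
      push_cast
      ring
    simp only [h3, h4]
    push_cast
    rfl
  · intro δ _
    refine Measurable.aestronglyMeasurable ?_
    fun_prop
  · filter_upwards [MeasureTheory.ae_restrict_mem hEm] with x hx
    refine DifferentiableOn.cpow_const (by fun_prop) fun δ hδ => ?_
    have h1 := hsmall δ hδ x hx
    refine Complex.mem_slitPlane_iff.2 (Or.inl ?_)
    have h2 := (abs_le.1 (Complex.abs_re_le_norm (δ / ((x - S.t j : ℝ) : ℂ)))).2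
    rw [Complex.sub_re, Complex.one_re]
    linarith
  · filter_upwards [MeasureTheory.ae_restrict_mem hEm] with x hx δ hδ
    have h1 := hsmall δ hδ x hx
    have hup : ‖1 - δ / ((x - S.t j : ℝ) : ℂ)‖ ≤ 3 / 2 := by
      refine (norm_sub_le _ _).trans ?_
      rw [norm_one]
      linarith
    have hlow : 1 / 2 ≤ ‖1 - δ / ((x - S.t j : ℝ) : ℂ)‖ := by
      have := norm_sub_norm_le (1 : ℂ) (δ / ((x - S.t j : ℝ) : ℂ))
      rw [norm_one] at this
      linarith
    rw [Complex.norm_cpow_real]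
    rcases ha with ha | ha
    · rw [ha]
      calc _ ≤ (3 / 2 : ℝ) ^ (((1 : ℤ) : ℝ) / 2) := by gcongr
        _ ≤ (3 / 2 : ℝ) ^ (1 : ℝ) :=
          Real.rpow_le_rpow_of_exponent_le (by norm_num) (by norm_num)
        _ ≤ 2 := by norm_num
    · rw [ha]
      calc _ ≤ (1 / 2 : ℝ) ^ (((-1 : ℤ) : ℝ) / 2) :=
            Real.rpow_le_rpow_of_nonpos (by norm_num) hlow (by norm_num)
        _ ≤ (1 / 2 : ℝ) ^ (-1 : ℝ) :=
          Real.rpow_le_rpow_of_exponent_ge (by norm_num) (by norm_num) (by norm_num)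
        _ ≤ 2 := by norm_num [Real.rpow_neg_one]

theorem AlternatesOn.staircase_gamma {S : SCData n} {i j : ℕ}
    (halt : S.AlternatesOn (min (i + 1) j) (max i (j + 1))) (hi : i ≤ n) (hjn : j + 1 ≤ n)
    (hij : i + 2 ≤ j ∨ j + 2 ≤ i) (hpar : Even (i + j)) (hS : StrictMonoOn S.t (Set.Icc 1 n)) :
    S.Staircase (min i j) (max i j) where
  strictMonoOn := hS
  lt := by omega
  le := by omega
  even := by rwa [min_add_max]
  alternates := halt.mono (by omega) (by omega)

theorem AlternatesOn.staircase_beta {S : SCData n} {i j : ℕ}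
    (halt : S.AlternatesOn (min (i + 1) j) (max i (j + 1))) (hj : 1 ≤ j) (hjn : j + 1 ≤ n)
    (hS : StrictMonoOn S.t (Set.Icc 1 n)) : S.Staircase (j - 1) (j + 1) where
  strictMonoOn := hS
  lt := by omega
  le := hjn
  even := by
    rw [Nat.even_iff]
    omega
  alternates := halt.mono (by omega) (by omega)

theorem oddEdges_pred_succ (S : SCData n) {j : ℕ} (hj : 1 ≤ j) :
    S.oddEdges (j - 1) (j + 1) = Set.Ioo (S.t j) (S.t (j + 1)) := by
  ext x
  constructor
  · rintro ⟨k, h1, h2, -, h4, h5⟩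
    obtain rfl : k = j := by omega
    exact ⟨h4, h5⟩
  · rintro ⟨h4, h5⟩
    exact ⟨j, by omega, by omega, by rw [Nat.odd_iff]; omega, h4, h5⟩

/-- The asymptotics of the two lengths when the vertices number `j` and `j + 1` collide. -/
theorem exists_analyticAt_lengths (S : SCData n) {i j : ℕ} (hi : i ≤ n) (hj : 1 ≤ j)
    (hjn : j + 1 ≤ n) (hij : i + 2 ≤ j ∨ j + 2 ≤ i) (hpar : Even (i + j))
    (hS : StrictMonoOn S.t (Set.Icc 1 n))
    (halt : S.AlternatesOn (min (i + 1) j) (max i (j + 1))) :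
    ∃ b g : ℝ → ℝ, AnalyticAt ℝ b 0 ∧ AnalyticAt ℝ g 0 ∧ ∀ᶠ δ in 𝓝[>] (0 : ℝ),
      0 < b δ ∧ S.betaLength j δ = b δ ∧
        S.gammaLength i j δ = g δ - side i j * S.a j * (Real.log δ / Real.pi * b δ) := by
  obtain ⟨L, hL, hiso⟩ := S.exists_isolated hj hjn hS
  have ha : S.a j = 1 ∨ S.a j = -1 := halt.1 j (Finset.mem_Icc.2 ⟨by omega, by omega⟩)
  have ha' : S.a (j + 1) = -S.a j := halt.2 j (Finset.mem_Ico.2 ⟨by omega, by omega⟩)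
  obtain ⟨b, g, hb, hg, hbg⟩ := exists_analyticAt_integral_collisionSide (τ := S.t j)
    (h := S.restNorm j) (side_eq i j) ha hL (hiso.differentiableOn hL)
    (fun x hx => hiso.restContinuation_ofReal hL hx)
  obtain ⟨u, hu, hfar⟩ := S.exists_analyticAt_far hL hi hj hjn hS halt
  refine ⟨b, fun δ => g δ + u δ, hb, hg.add hu, ?_⟩
  filter_upwards [Ioo_mem_nhdsGT (by linarith : (0 : ℝ) < L / 2)] with δ hδ
  have hδL : δ < L := by linarith [hδ.2]
  have hSδ := hiso.strictMonoOn_moveVertex hj hjn hS hδ.1 hδL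
  have haltδ : (S.moveVertex j δ).AlternatesOn (min (i + 1) j) (max i (j + 1)) := halt
  have hβ := haltδ.staircase_beta hj hjn hSδ
  have hγ := haltδ.staircase_gamma hi hjn hij hpar hSδ
  obtain ⟨h1, h2⟩ := hbg δ hδ.1 hδL
  have hf : ∀ x : ℝ, ‖(S.moveVertex j δ).integrand x‖ = |x - S.t j| ^ ((S.a j : ℝ) / 2) *
      |x - S.t j - δ| ^ (((-S.a j : ℤ) : ℝ) / 2) * S.restNorm j (x - S.t j) := fun x => by
    rw [S.norm_integrand_moveVertex hj hjn, ha']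
  have hbeta : S.betaLength j δ = b δ := by
    rw [betaLength, hβ.norm_period, oddEdges_pred_succ _ hj, moveVertex_t_succ,
      moveVertex_t_of_ne _ _ (Nat.succ_ne_self j).symm, ← h1]
    simp only [hf]
  refine ⟨?_, hbeta, ?_⟩
  · rw [← hbeta, betaLength, hβ.norm_period]
    exact hβ.integral_pos
  · have hopen : IsOpen {x | |x - S.t j| < L} := isOpen_lt (by fun_prop) continuous_const
    rw [gammaLength, hγ.norm_period, ← MeasureTheory.integral_inter_add_sdiff hopen.measurableSet
      (hγ.integrableOn_norm.mono_set (hγ.oddEdges_subset.trans Set.Ioc_subset_Icc_self)),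
      Set.sdiff_eq, hfar δ hδ.1 hδ.2,
      hiso.oddEdges_inter_near hi hj hjn hij hpar hS hδ.1 hδL]
    simp only [hf]
    rw [h2]
    ring

/-- The argument of the period of `γ` relative to that of `β`. -/
theorem exists_period_eq (S : SCData n) {i j : ℕ} (hi : i ≤ n) (hj : 1 ≤ j)
    (hjn : j + 1 ≤ n) (hij : i + 2 ≤ j ∨ j + 2 ≤ i) (hpar : Even (i + j))
    (hS : StrictMonoOn S.t (Set.Icc 1 n))
    (halt : S.AlternatesOn (min (i + 1) j) (max i (j + 1))) :
    ∃ (N : ℤ) (g b : ℝ), 0 < g ∧ 0 < b ∧ S.period (j - 1) (j + 1) = -Complex.I ^ N * b ∧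
      S.period (min i j) (max i j) = -Complex.I ^ (N + S.a j) * g := by
  have hβ := halt.staircase_beta hj hjn hS
  have hγ := halt.staircase_gamma hi hjn hij hpar hS
  refine ⟨_, _, _, hγ.integral_pos, hβ.integral_pos, hβ.period_eq, ?_⟩
  rw [hγ.period_eq]
  congr 3
  have hN : ∑ l ∈ Finset.Ioc j n, S.a l =
      ∑ l ∈ Finset.Ioc (j + 1) n, S.a l + S.a (j + 1) := by
    have : Finset.Ioc j n = insert (j + 1) (Finset.Ioc (j + 1) n) := by
      ext l
      simp only [Finset.mem_Ioc, Finset.mem_insert]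
      omega
    rw [this, Finset.sum_insert (by simp), add_comm]
  rw [← hN]
  rcases hij with hij | hij
  · rw [max_eq_right (by omega)]
  · rw [max_eq_left (by omega)]
    have halt' : S.AlternatesOn (j - 1 + 1) i := halt.mono (by omega) (by omega)
    have he : Even (i - j) := by
      rw [Nat.even_iff] at hpar ⊢
      omega
    have h1 := halt'.sum_Ioc_sub hi (m := i - j) (by omega)
    have h2 := halt'.apply_sub (m := i - j) (by omega)
    rw [if_pos he, show i - (i - j) = j by omega] at h1 h2
    rw [h1, h2, add_zero]

theorem Staircase.edgesParallel {S : SCData n} {p q : ℕ} (h : S.Staircase p q) :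
    S.EdgesParallel p q := by
  have h1 : ∀ m, p + m ≤ q → (Even (∑ k ∈ Finset.Ioc p (p + m), S.a k) ↔ Even m) := by
    intro m
    induction m with
    | zero => simp
    | succ m ih =>
      intro hm
      rw [← add_assoc, Finset.sum_Ioc_succ_top (by omega), Int.even_add, ih (by omega),
        Nat.even_add_one]
      have : ¬ Even (S.a (p + m + 1)) := by
        rcases h.alternates.1 (p + m + 1) (Finset.mem_Icc.2 ⟨by omega, by omega⟩) with h3 | h3 <;>
        rw [h3] <;> decide
      tauto
  have hlt := h.lt
  have heven := h.even
  have h2 := h1 (q - p) (by omega)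
  rw [show p + (q - p) = q by omega] at h2
  refine h2.2 ?_
  rw [Nat.even_iff] at heven ⊢
  omega

theorem Staircase.finiteBetween {S : SCData n} {p q : ℕ} (h : S.Staircase p q) :
    S.FiniteBetween p q := by
  intro k hk
  rw [Finset.mem_Ioc] at hk
  rcases h.alternates.1 k (Finset.mem_Icc.2 hk) with h3 | h3 <;> rw [h3] <;> norm_num

end SCData

/-- The exponents at the colliding vertices of conjugate orthodisks are opposite. -/
theorem Orthodisk.IsConjugate.exponent_eq_neg {n i j : ℕ} {O₁ O₂ : Orthodisk n}
    (hconj : O₁.IsConjugate O₂) (hi : i ≤ n) (hj : 1 ≤ j)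
    (hjn : j + 1 ≤ n) (hij : i + 2 ≤ j ∨ j + 2 ≤ i) (hpar : Even (i + j))
    (h₁ : O₁.AlternatesOn (min (i + 1) j) (max i (j + 1)))
    (h₂ : O₂.AlternatesOn (min (i + 1) j) (max i (j + 1))) : O₂.a j = -O₁.a j := by
  obtain ⟨c, hc, hper, -⟩ := hconj
  have hmem : j ∈ Finset.Icc (min (i + 1) j) (max i (j + 1)) :=
    Finset.mem_Icc.2 ⟨by omega, by omega⟩
  by_contra hne
  have heq : O₂.a j = O₁.a j := by
    rcases h₁.1 j hmem with e1 | e1 <;> rcases h₂.1 j hmem with e2 | e2 <;> rw [e1, e2] at hne ⊢ <;>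
    simp at hne
  have hβ₁ := h₁.staircase_beta hj hjn O₁.strictMonoOn
  have hβ₂ := h₂.staircase_beta hj hjn O₂.strictMonoOn
  have hγ₁ := h₁.staircase_gamma hi hjn hij hpar O₁.strictMonoOn
  have hγ₂ := h₂.staircase_gamma hi hjn hij hpar O₂.strictMonoOn
  have pβ := hper _ _ hβ₁.lt hβ₁.le hβ₁.edgesParallel hβ₂.edgesParallel hβ₁.finiteBetween
    hβ₂.finiteBetween
  have pγ := hper _ _ hγ₁.lt hγ₁.le hγ₁.edgesParallel hγ₂.edgesParallel hγ₁.finiteBetween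
    hγ₂.finiteBetween
  obtain ⟨N₁, g₁, b₁, hg₁, hb₁, eβ₁, eγ₁⟩ :=
    O₁.exists_period_eq hi hj hjn hij hpar O₁.strictMonoOn h₁
  obtain ⟨N₂, g₂, b₂, hg₂, hb₂, eβ₂, eγ₂⟩ :=
    O₂.exists_period_eq hi hj hjn hij hpar O₂.strictMonoOn h₂
  rw [eβ₁, eβ₂] at pβ
  rw [eγ₁, eγ₂, heq] at pγ
  simp only [map_mul, map_neg, Complex.conj_ofReal, Complex.conj_I_zpow] at pβ pγ
  have hodd : (-1 : ℂ) ^ O₁.a j = -1 := by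
    rcases h₁.1 j hmem with e1 | e1 <;> rw [e1] <;> simp
  rw [zpow_add₀ Complex.I_ne_zero, zpow_add₀ Complex.I_ne_zero,
    zpow_add₀ (by norm_num : (-1 : ℂ) ≠ 0), hodd] at pγ
  have hI₁ : Complex.I ^ N₁ ≠ 0 := zpow_ne_zero _ Complex.I_ne_zero
  have hI₂ : Complex.I ^ N₂ ≠ 0 := zpow_ne_zero _ Complex.I_ne_zero
  have hIa : Complex.I ^ O₁.a j ≠ 0 := zpow_ne_zero _ Complex.I_ne_zero
  have hprod : Complex.I ^ N₂ * Complex.I ^ O₁.a j * (g₂ * b₁ + b₂ * g₁) *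
      ((-1) ^ N₁ * Complex.I ^ N₁) = 0 := by
    linear_combination (-(b₁ : ℂ) * ((-1) ^ N₁ * Complex.I ^ N₁)) * pγ -
      (g₁ : ℂ) * Complex.I ^ O₁.a j * ((-1) ^ N₁ * Complex.I ^ N₁) * pβ
  have hne1 : (-1 : ℂ) ^ N₁ ≠ 0 := zpow_ne_zero _ (by norm_num)
  have hsum : (g₂ : ℂ) * b₁ + b₂ * g₁ = 0 := by
    rcases mul_eq_zero.1 hprod with h | h
    · exact (mul_eq_zero.1 h).resolve_left (mul_ne_zero hI₂ hIa)
    · exact absurd h (mul_ne_zero hne1 hI₁)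
  have hsum' : g₂ * b₁ + b₂ * g₁ = 0 := by exact_mod_cast hsum
  have : 0 < g₂ * b₁ + b₂ * g₁ := by positivity
  linarith

/-- The logarithm times an analytic function does not extend analytically to `0`. -/
theorem not_extendsAnalyticallyToZero_log_mul {b : ℝ → ℝ} (hb : AnalyticAt ℝ b 0)
    (hpos : ∀ᶠ δ in 𝓝[>] (0 : ℝ), 0 < b δ) :
    ¬ ExtendsAnalyticallyToZero fun δ => Real.log δ * b δ := by
  rintro ⟨g, hg, heq⟩
  have hne : ∀ {f : ℝ → ℝ}, (∀ᶠ δ in 𝓝[>] (0 : ℝ), f δ ≠ 0) → ¬ ∀ᶠ δ in 𝓝 (0 : ℝ), f δ = 0 := by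
    intro f h1 h2
    obtain ⟨δ, h3, h4⟩ := (h1.and (h2.filter_mono nhdsWithin_le_nhds)).exists
    exact h3 h4
  have hsmall : ∀ᶠ δ in 𝓝[>] (0 : ℝ), δ ∈ Set.Ioo (0 : ℝ) 1 := Ioo_mem_nhdsGT one_pos
  obtain ⟨m, u, hu, hu0, hbu⟩ := hb.exists_eventuallyEq_pow_smul_nonzero_iff.2
    (hne (hpos.mono fun δ h => h.ne'))
  obtain ⟨k, v, hv, hv0, hgv⟩ := hg.exists_eventuallyEq_pow_smul_nonzero_iff.2
    (hne (by
      filter_upwards [hpos, heq, hsmall] with δ h1 h2 h3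
      rw [← h2]
      exact mul_ne_zero (Real.log_neg h3.1 h3.2).ne h1.ne'))
  simp only [sub_zero, smul_eq_mul] at hbu hgv
  have hkey : ∀ᶠ δ in 𝓝[>] (0 : ℝ), Real.log δ * (δ ^ m * u δ) = δ ^ k * v δ := by
    filter_upwards [heq, hbu.filter_mono nhdsWithin_le_nhds, hgv.filter_mono nhdsWithin_le_nhds]
      with δ h1 h2 h3
    rw [← h2, ← h3, h1]
  have hu' : Tendsto u (𝓝[>] 0) (𝓝 (u 0)) := hu.continuousAt.tendsto.mono_left nhdsWithin_le_nhds
  have hv' : Tendsto v (𝓝[>] 0) (𝓝 (v 0)) := hv.continuousAt.tendsto.mono_left nhdsWithin_le_nhds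
  have hid : Tendsto (fun δ : ℝ => δ) (𝓝[>] 0) (𝓝 0) := tendsto_id.mono_left nhdsWithin_le_nhds
  rcases le_or_gt m k with hmk | hmk
  · have h1 : Tendsto (fun δ : ℝ => δ ^ (k - m) * v δ / u δ) (𝓝[>] 0)
        (𝓝 ((0 : ℝ) ^ (k - m) * v 0 / u 0)) := ((hid.pow _).mul hv').div hu' hu0
    refine not_tendsto_nhds_of_tendsto_atBot Real.tendsto_log_nhdsGT_zero _ (h1.congr' ?_)
    filter_upwards [hkey, hsmall, hu'.eventually_ne hu0] with δ h2 h3 h4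
    rw [div_eq_iff h4]
    have h5 : δ ^ m ≠ 0 := pow_ne_zero _ h3.1.ne'
    refine mul_left_cancel₀ h5 ?_
    rw [← mul_assoc, ← pow_add, Nat.add_sub_cancel' hmk, ← h2]
    ring
  · have h1 : Tendsto (fun δ : ℝ => Real.log δ * δ ^ (m - k) * u δ) (𝓝[>] 0) (𝓝 (0 * u 0)) := by
      refine Tendsto.mul ?_ hu'
      have := tendsto_log_mul_rpow_nhdsGT_zero (r := ((m - k : ℕ) : ℝ))
        (by exact_mod_cast Nat.sub_pos_of_lt hmk)
      simpa only [Real.rpow_natCast] using this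
    have h2 : Tendsto v (𝓝[>] 0) (𝓝 (0 * u 0)) := by
      refine h1.congr' ?_
      filter_upwards [hkey, hsmall] with δ h2 h3
      have h5 : δ ^ k ≠ 0 := pow_ne_zero _ h3.1.ne'
      refine mul_left_cancel₀ h5 ?_
      rw [← h2]
      nth_rewrite 2 [← Nat.add_sub_cancel' hmk.le]
      rw [pow_add]
      ring
    rw [zero_mul] at h2
    exact hv0 (tendsto_nhds_unique hv' h2)

namespace SCData

variable {n : ℕ}

/-- The sign of the logarithmic term is determined by the exponent of vertex number `j`. -/
theorem minusAnalytic_plusAnalytic_iff (S : SCData n) {i j : ℕ} (hi : i ≤ n) (hj : 1 ≤ j)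
    (hjn : j + 1 ≤ n) (hij : i + 2 ≤ j ∨ j + 2 ≤ i) (hpar : Even (i + j))
    (hS : StrictMonoOn S.t (Set.Icc 1 n))
    (halt : S.AlternatesOn (min (i + 1) j) (max i (j + 1))) :
    (S.MinusAnalytic i j ↔ side i j * S.a j = -1) ∧
      (S.PlusAnalytic i j ↔ side i j * S.a j = 1) := by
  obtain ⟨b, g, hb, hg, hev⟩ := S.exists_analyticAt_lengths hi hj hjn hij hpar hS halt
  have hnot := not_extendsAnalyticallyToZero_log_mul hb (hev.mono fun δ h => h.1)
  have hs : side i j * S.a j = 1 ∨ side i j * S.a j = -1 := by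
    rcases side_eq i j with h | h <;>
    rcases halt.1 j (Finset.mem_Icc.2 ⟨by omega, by omega⟩) with h' | h' <;> rw [h, h'] <;> simp
  have hpi := Real.pi_ne_zero
  have hmin : side i j * S.a j = -1 → S.MinusAnalytic i j := by
    intro h
    refine ⟨g, hg, ?_⟩
    filter_upwards [hev] with δ hδ
    rw [hδ.2.1, hδ.2.2, h]
    ring
  have hplus : side i j * S.a j = 1 → S.PlusAnalytic i j := by
    intro h
    refine ⟨g, hg, ?_⟩
    filter_upwards [hev] with δ hδ
    rw [hδ.2.1, hδ.2.2, h]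
    ring
  have hboth : ¬ (S.MinusAnalytic i j ∧ S.PlusAnalytic i j) := by
    rintro ⟨⟨u, hu, hu'⟩, ⟨v, hv, hv'⟩⟩
    refine hnot ⟨fun δ => Real.pi / 2 * (v δ - u δ), analyticAt_const.mul (hv.sub hu), ?_⟩
    filter_upwards [hu', hv', hev] with δ h1 h2 h3
    rw [← h1, ← h2, h3.2.1]
    field_simp
    ring
  refine ⟨⟨fun h => hs.resolve_left fun h1 => hboth ⟨h, hplus h1⟩, hmin⟩,
    ⟨fun h => hs.resolve_right fun h1 => hboth ⟨hmin h1, h⟩, hplus⟩⟩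

end SCData

theorem lemma4p35 {n : ℕ} (i j : ℕ) (hi : i ≤ n) (hj : 1 ≤ j) (hjn : j + 1 ≤ n)
    (hij : i + 2 ≤ j ∨ j + 2 ≤ i) (hpar : Even (i + j))
    (O₁ O₂ : Orthodisk n) (hconj : O₁.IsConjugate O₂)
    (h₁ : O₁.AlternatesOn (min (i + 1) j) (max i (j + 1)))
    (h₂ : O₂.AlternatesOn (min (i + 1) j) (max i (j + 1))) :
    Xor (O₁.MinusAnalytic i j) (O₁.PlusAnalytic i j) ∧
      (O₁.MinusAnalytic i j → O₂.PlusAnalytic i j) ∧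
      (O₁.PlusAnalytic i j → O₂.MinusAnalytic i j) := by
  obtain ⟨hm₁, hp₁⟩ := O₁.minusAnalytic_plusAnalytic_iff hi hj hjn hij hpar O₁.strictMonoOn h₁
  obtain ⟨hm₂, hp₂⟩ := O₂.minusAnalytic_plusAnalytic_iff hi hj hjn hij hpar O₂.strictMonoOn h₂
  have hneg := hconj.exponent_eq_neg hi hj hjn hij hpar h₁ h₂
  have hs : SCData.side i j * O₁.a j = 1 ∨ SCData.side i j * O₁.a j = -1 := by
    rcases SCData.side_eq i j with h | h <;>
    rcases h₁.1 j (Finset.mem_Icc.2 ⟨by omega, by omega⟩) with h' | h' <;> rw [h, h'] <;> simp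
  rw [hm₁, hp₁, hm₂, hp₂, hneg]
  push_cast
  rw [mul_neg]
  rcases hs with h | h <;> rw [h] <;> norm_num
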